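/- **Setting.** Let $\mathcal P$ be a finite set of modes, $n\ge 1$, and consider the switched system $\dot x=A_\sigma x+B_\sigma u$, $y=C_\sigma x$ with $x(t)\in\mathbb R^n$, $u(t)\in\mathbb R^m$, $y(t)\in\mathbb R^{l}$, where $\sigma:[0,\infty)\to\mathcal P$ is right-continuous and piecewise constant. Let $N_\sigma(t,s)$ be the number of discontinuities of $\sigma$ in $(s,t]$ and $\tau_s>0$ the sampling period. Assume the dwell-time condition $N_\sigma(t,s)\le 1$ whenever $0\le s\le t$ and $t-s\le\tau_s$, and the average dwell-time condition $N_\sigma(t,s)\le N_0+(t-s)/\tau_a$ for all $t>s\ge0$, with $\tau_a>0$, $N_0\in\mathbb N$. The norms $|\cdot|$, $\|\cdot\|$ are Euclidean, $|\cdot|_\infty,\|\cdot\|_\infty$ are the maximum norm and its induced norm. Let $\eta_p$ be the least number such that $W_p=[C_p;\,C_pe^{A_p\tau_s};\dots;\,C_pe^{A_p(\eta_p-1)\tau_s}]$ has full column rank (assumed to exist), $W_p^\dagger$ a left inverse of $W_p$, $\eta=\max_p\eta_p$. Let $K_p$ be such that $A_p+B_pK_p$ is Hurwitz, and let $N$ be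 an odd positive integer with $$\theta_p:=\frac1N\|e^{A_p\eta_p\tau_s}W_p^\dagger\|_\infty\max_{0\le k<\eta_p}\|C_pe^{A_pk\tau_s}\|_\infty<1\qquad(p\in\mathcal P).$$ Put $\bar A_p=e^{(A_p+B_pK_p)\eta_p\tau_s}$, $\bar B_p=\int_0^{\eta_p\tau_s}e^{(A_p+B_pK_p)(\eta_p\tau_s-t)}B_pK_pe^{A_pt}\,dt$; let $P_p,Q_p$ be positive definite with $\bar A_p^\top P_p\bar A_p-P_p=-Q_p$, let $\kappa_p>1$, $$\alpha_p=\tfrac1{\kappa_p}\lambda_{\min}(Q_p),\qquad \beta_p=n\Bigl(\tfrac{\kappa_p}{\kappa_p-1}\tfrac{\|\bar A_p^\top P_p\bar B_p\|^2}{\lambda_{\min}(Q_p)}+\|\bar B_p^\top P_p\bar B_p\|\Bigr),$$ let $\rho_p>0$, $\rho_p>\beta_p/(1-\theta_p^2)$, and put $$V_p(x,E)=x^\top P_px+\rho_pE^2,\qquad \nu_p=\max\Bigl\{1-\tfrac{\alpha_p}{\lambda_{\max}(P_p)},\ \tfrac{\beta_p}{\rho_p}+\theta_p^2\Bigr\},\qquad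 \nu=\max_p\nu_p .$$ For $p\ne q$, $1\le k\le\eta_p$, $0\le\tau\le\tau_s$ put $\tau(k)=\tau+(k-1)\tau_s$, $H_{p,q}=A_q-A_p+(B_q-B_p)K_p$, $M_{p,q}(k,\tau)=\int_\tau^{\tau_s}e^{A_q(\tau_s-t)}B_qK_pe^{(A_p+B_pK_p)(t+(k-1)\tau_s)}dt$ and $$\bar\delta_{p,q}(k)=\max_{\tau}\Bigl\|\int_\tau^{\tau_s}e^{A_q(\tau_s-t)}H_{p,q}e^{(A_p+B_pK_p)(t+(k-1)\tau_s)}dt\Bigr\|_\infty,\quad \bar\gamma'_{p,q}(k)=\max_\tau\|e^{A_q(\tau_s-\tau)}e^{A_p\tau(k)}\|_\infty,\quad \bar\gamma_{p,q}=\bar\delta_{p,q}+\bar\gamma'_{p,q},$$ $$\bar\alpha_{p,q}(k)=\max_\tau\|e^{A_q(\tau_s-\tau)}e^{(A_p+B_pK_p)\tau(k)}+M_{p,q}(k,\tau)\|,$$ $$\bar\beta_{p,q}(k)=\sqrt n\max_\tau\Bigl\|e^{A_q(\tau_s-\tau)}\int_0^{\tau(k)}e^{(A_p+B_pK_p)(\tau(k)-t)}B_pK_pe^{A_pt}dt+M_{p,q}(k,\tau)\Bigr\|,$$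 $$\bar\nu_{p,q}(k)=\max\Bigl\{\tfrac{2(\lambda_{\max}(P_q)\bar\alpha_{p,q}(k)^2+\rho_q\bar\delta_{p,q}(k)^2)}{\lambda_{\min}(P_p)},\ \tfrac{2(\lambda_{\max}(P_q)\bar\beta_{p,q}(k)^2+\rho_q\bar\gamma_{p,q}(k)^2)}{\rho_p}\Bigr\},\qquad \bar\nu=\max_{p\ne q}\max_{1\le k\le\eta_p}\bar\nu_{p,q}(k).$$ (If there is only one mode, read $\log\bar\nu=0$.) **Zooming-in strategy** from sample $k_0$, with an estimate $\xi(k_0\tau_s)$ and a bound $E_{k_0}$ such that $|x(k_0\tau_s)-\xi(k_0\tau_s)|_\infty\le E_{k_0}$. The strategy proceeds in blocks. A block starting at sample $k$ with $p=\sigma(k\tau_s)$ has length $L$, the least $i\in[1,\eta_p]$ with $\sigma((k+i-1)\tau_s)\ne\sigma((k+i)\tau_s)$, or $\eta_p$ if there is none; the next block starts at $k+L$. On $[k\tau_s,(k+L)\tau_s)$, $\dot\xi=(A_p+B_pK_p)\xi$ and $u=K_p\xi$; for $0\le i<L$ the cube $\{|y-\hat y_{k+i}|_\infty\le\|C_pe^{A_pi\tau_s}\|_\infty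 E_k\}$, $\hat y_{k+i}=C_p\xi((k+i)\tau_s)$, is divided into $N^{l}$ equal boxes, $q_{k+i}$ is the centre of a box containing $y((k+i)\tau_s)$, and $E_{k+i}=E_k$. If $\sigma((k+L)\tau_s)=p$ (no switch, $L=\eta_p$), then $\xi((k+L)\tau_s)=\bar A_p\xi(k\tau_s)+e^{A_p\eta_p\tau_s}W_p^\dagger[q_{k+i}-\hat y_{k+i}]_{0\le i<\eta_p}$ and $E_{k+L}=\theta_pE_k$. If $\sigma((k+L)\tau_s)=q\neq p$, then $\xi((k+L)\tau_s)=e^{(A_p+B_pK_p)L\tau_s}\xi(k\tau_s)$ and $E_{k+L}=\bar\delta_{p,q}(L)|\xi(k\tau_s)|_\infty+\bar\gamma'_{p,q}(L)E_k$. **Zooming-out strategy** from time $0$: fix $\mu_0,\chi>0$, $\mu_i=e^{(1+\chi)\max_p\|A_p\|_\infty i\tau_s}\mu_0$, and apply $u=0$ until samples $n_0,\dots,n_0+\eta_p-1$, $p=\sigma(n_0\tau_s)$, have been found ($n_0$ minimal) at which the mode is $p$ and $|y(i\tau_s)|_\infty\le\mu_i$, and up to time $(n_0+\eta_p)\tau_s$.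 Then zoom in from $k_0=n_0+\eta_p$ with $\xi(k_0\tau_s)=0$ and $E_{k_0}=e^{\max_p\|A_p\|_\infty\tau_s}\|e^{A_p(\eta_p-1)\tau_s}\|_\infty\|W_p^\dagger\|_\infty\,\mu_{n_0+\eta_p-1}$. **Statement.** Suppose that $$\tau_a>\Bigl(1+\frac{\log\bar\nu}{\log(1/\nu)}\Bigr)\eta\tau_s .$$ (a) For every closed-loop trajectory under the zooming-in strategy, from any sample $k_0$ and any $\xi(k_0\tau_s)$, $E_{k_0}$ with $|x(k_0\tau_s)-\xi(k_0\tau_s)|_\infty\le E_{k_0}$, one has $V_{\sigma(k\tau_s)}(x(k\tau_s),E_k)\to0$ as $k\to\infty$ and $x(t)\to0$ as $t\to\infty$. (b) Suppose moreover that $\tau_a>\eta\tau_s$ (which is automatic if $\bar\nu\ge1$) and that $A_p\ne0$ for some $p$. Then for every $x(0)$, every closed-loop trajectory under the zooming-out strategy followed by the zooming-in strategy leaves the zooming-out stage ($n_0$ exists) and satisfies $V_{\sigma(k\tau_s)}(x(k\tau_s),E_k)\to0$ as $k\to\infty$ and $x(t)\to0$ as $t\to\infty$. -/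

import Mathlib

open Set Filter Topology
open scoped Matrix

noncomputable section

/-! ### Norms, eigenvalues and matrix-valued functions -/

/-- The norm of a matrix induced by the maximum norms (the norm of `Fin n → ℝ`). -/
def infNorm {α β : Type*} [Fintype α] [Fintype β] [DecidableEq β] (M : Matrix α β ℝ) : ℝ :=
  ‖LinearMap.toContinuousLinearMap (Matrix.toLin' M)‖

/-- The norm of a matrix induced by the Euclidean norms. -/
def eucNorm {n : ℕ} (M : Matrix (Fin n) (Fin n) ℝ) : ℝ :=
  ‖LinearMap.toContinuousLinearMap (Matrix.toEuclideanLin M)‖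

/-- Smallest (real) eigenvalue; used for symmetric matrices only. -/
def lamMin {n : ℕ} (M : Matrix (Fin n) (Fin n) ℝ) : ℝ := sInf (spectrum ℝ M)

/-- Largest (real) eigenvalue; used for symmetric matrices only. -/
def lamMax {n : ℕ} (M : Matrix (Fin n) (Fin n) ℝ) : ℝ := sSup (spectrum ℝ M)

/-- All complex eigenvalues have negative real part. -/
def IsHurwitz {n : ℕ} (M : Matrix (Fin n) (Fin n) ℝ) : Prop :=
  ∀ z ∈ spectrum ℂ (M.map (algebraMap ℝ ℂ)), z.re < 0

/-- `e^{tM}`. -/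
def mexp {n : ℕ} (M : Matrix (Fin n) (Fin n) ℝ) (t : ℝ) : Matrix (Fin n) (Fin n) ℝ :=
  NormedSpace.exp (t • M)

/-- Entrywise integral of a matrix-valued function. -/
def mint {n : ℕ} (F : ℝ → Matrix (Fin n) (Fin n) ℝ) (a b : ℝ) : Matrix (Fin n) (Fin n) ℝ :=
  Matrix.of fun i j => ∫ t in a..b, F t i j

/-! ### Switching signals -/

section Switching

variable {ι : Type*}

/-- The switching times: the discontinuities of `σ` on `(0, ∞)`, for the discrete topology on
the set of modes. -/
def switchTimes (σ : ℝ → ι) : Set ℝ := {T | 0 < T ∧ ¬ ∀ᶠ t in 𝓝 T, σ t = σ T}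

/-- `N_σ(t, s)`: the number of switching times in `(s, t]`. -/
def numSwitches (σ : ℝ → ι) (t s : ℝ) : ℕ := (switchTimes σ ∩ Ioc s t).ncard

/-- `σ` is right-continuous and piecewise constant on `[0, ∞)`
(finitely many discontinuities in every bounded interval). -/
structure IsSwitchingSignal (σ : ℝ → ι) : Prop where
  rightCont : ∀ t, 0 ≤ t → ∀ᶠ s in 𝓝[>] t, σ s = σ t
  finite : ∀ t, (switchTimes σ ∩ Iic t).Finite

/-- At most one switch in every interval `(s, t]` of length at most `τs`. -/
def HasDwellTime (σ : ℝ → ι) (τs : ℝ) : Prop :=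
  ∀ s t, 0 ≤ s → s ≤ t → t - s ≤ τs → numSwitches σ t s ≤ 1

/-- Average dwell time `τa` with chatter bound `N0`. -/
def HasAverageDwellTime (σ : ℝ → ι) (τa : ℝ) (N0 : ℕ) : Prop :=
  ∀ s t, 0 ≤ s → s < t → (numSwitches σ t s : ℝ) ≤ N0 + (t - s) / τa

end Switching

/-! ### The plant -/

/-- The matrices of the switched linear system `x' = A_σ x + B_σ u`, `y = C_σ x`. -/
structure SwitchedSystem (ι : Type*) (n m l : ℕ) where
  A : ι → Matrix (Fin n) (Fin n) ℝ
  B : ι → Matrix (Fin n) (Fin m) ℝ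
  C : ι → Matrix (Fin l) (Fin n) ℝ

namespace SwitchedSystem

variable {ι : Type*} {n m l : ℕ} (S : SwitchedSystem ι n m l)

/-- The stacked matrix with block rows `C_p e^{A_p i τs}`, `i = 0, …, h - 1`. -/
def W (τs : ℝ) (p : ι) (h : ℕ) : Matrix (Fin h × Fin l) (Fin n) ℝ :=
  Matrix.of fun a j => (S.C p * mexp (S.A p) ((a.1 : ℕ) * τs)) a.2 j

/-- `η_p`: the smallest number of block rows for which `W_p` has full column rank. -/
def eta (τs : ℝ) (p : ι) : ℕ := sInf {h | (S.W τs p h).rank = n}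

/-- `η = max_p η_p`. -/
def etaMax [Fintype ι] (τs : ℝ) : ℕ := Finset.univ.sup (S.eta τs)

/-- `max_p ‖A_p‖_∞`. -/
def maxA : ℝ := ⨆ p, infNorm (S.A p)

/-- On `[t₀, ∞)` the function `x` is a (continuous) solution of `x' = A_σ x + B_σ u`.
As `σ` and `u` are piecewise continuous and right-continuous, the equation is asked
for the right derivative at every time. -/
def IsSolution (σ : ℝ → ι) (u : ℝ → Fin m → ℝ) (x : ℝ → Fin n → ℝ) (t₀ : ℝ) : Prop :=
  ContinuousOn x (Ici t₀) ∧
    ∀ t, t₀ ≤ t → HasDerivWithinAt x (S.A (σ t) *ᵥ x t + S.B (σ t) *ᵥ u t) (Ici t) t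

end SwitchedSystem

/-! ### The encoder and controller -/

/-- The chosen data: feedback gains `K_p`, left inverses `Wd_p` of `W_p`, number `N` of
quantization levels per output coordinate, matrices `P_p`, `Q_p` and numbers `ρ_p`, `κ_p` of the
Lyapunov functions. -/
structure Design {ι : Type*} {n m l : ℕ} (S : SwitchedSystem ι n m l) (τs : ℝ) where
  K : ι → Matrix (Fin m) (Fin n) ℝ
  Wd : (p : ι) → Matrix (Fin n) (Fin (S.eta τs p) × Fin l) ℝ
  N : ℕ
  P : ι → Matrix (Fin n) (Fin n) ℝ
  Q : ι → Matrix (Fin n) (Fin n) ℝ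
  rho : ι → ℝ
  kappa : ι → ℝ

/-- The hypercube `{y : |y - c|_∞ ≤ r}` is divided into `N^l` equal boxes, and `q` is the
centre of one of these boxes that contains `y`. -/
def IsQuantizedValue {l : ℕ} (N : ℕ) (c : Fin l → ℝ) (r : ℝ) (y q : Fin l → ℝ) : Prop :=
  ∃ a : Fin l → Fin N, ∀ i,
    q i = c i + r * (2 * ((a i : ℕ) : ℝ) + 1 - N) / N ∧ |y i - q i| ≤ r / N

namespace Design

variable {ι : Type*} {n m l : ℕ} {S : SwitchedSystem ι n m l} {τs : ℝ} (D : Design S τs)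

/-- The closed-loop matrix `A_p + B_p K_p`. -/
def Acl (p : ι) : Matrix (Fin n) (Fin n) ℝ := S.A p + S.B p * D.K p

/-- `‖e^{A_p η_p τs} Wd_p‖_∞ · max_{0 ≤ k ≤ η_p - 1} ‖C_p e^{A_p k τs}‖_∞`. -/
def rate (p : ι) : ℝ :=
  infNorm (mexp (S.A p) (S.eta τs p * τs) * D.Wd p) *
    ⨆ k : Fin (S.eta τs p), infNorm (S.C p * mexp (S.A p) ((k : ℕ) * τs))

def theta (p : ι) : ℝ := D.rate p / D.N

def Abar (p : ι) : Matrix (Fin n) (Fin n) ℝ := mexp (D.Acl p) (S.eta τs p * τs)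

def Bbar (p : ι) : Matrix (Fin n) (Fin n) ℝ :=
  mint (fun t => mexp (D.Acl p) (S.eta τs p * τs - t) * (S.B p * D.K p) * mexp (S.A p) t)
    0 (S.eta τs p * τs)

def alpha (p : ι) : ℝ := 1 / D.kappa p * lamMin (D.Q p)

def beta (p : ι) : ℝ :=
  n * (D.kappa p / (D.kappa p - 1) *
      (eucNorm ((D.Abar p)ᵀ * D.P p * D.Bbar p) ^ 2 / lamMin (D.Q p)) +
    eucNorm ((D.Bbar p)ᵀ * D.P p * D.Bbar p))

/-- The requirements on the chosen data. -/
structure IsAdmissible : Prop where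
  hurwitz : ∀ p, IsHurwitz (D.Acl p)
  leftInverse : ∀ p, D.Wd p * S.W τs p (S.eta τs p) = 1
  odd : Odd D.N
  dataRate : ∀ p, D.rate p < D.N
  posDefP : ∀ p, (D.P p).PosDef
  posDefQ : ∀ p, (D.Q p).PosDef
  lyapunov : ∀ p, (D.Abar p)ᵀ * D.P p * D.Abar p - D.P p = - D.Q p
  one_lt_kappa : ∀ p, 1 < D.kappa p
  rho_pos : ∀ p, 0 < D.rho p
  lt_rho : ∀ p, D.beta p / (1 - D.theta p ^ 2) < D.rho p

/-- The Lyapunov function `V_p(x, E) = xᵀ P_p x + ρ_p E²`. -/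
def V (p : ι) (x : Fin n → ℝ) (E : ℝ) : ℝ := x ⬝ᵥ (D.P p *ᵥ x) + D.rho p * E ^ 2

/-- The decrease factor of `V_p` over `η_p` samples without a switch. -/
def nu_p (p : ι) : ℝ :=
  max (1 - D.alpha p / lamMax (D.P p)) (D.beta p / D.rho p + D.theta p ^ 2)

/-- `ν = max_p ν_p`. -/
def nu : ℝ := ⨆ p, D.nu_p p

def H (p q : ι) : Matrix (Fin n) (Fin n) ℝ :=
  (S.A q - S.A p) + (S.B q - S.B p) * D.K p

def deltaBar (p q : ι) (k : ℕ) : ℝ :=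
  ⨆ τ : Icc (0 : ℝ) τs, infNorm
    (mint (fun t => mexp (S.A q) (τs - t) * D.H p q * mexp (D.Acl p) (t + ((k : ℝ) - 1) * τs))
      τ τs)

def gammaBar' (_D : Design S τs) (p q : ι) (k : ℕ) : ℝ :=
  ⨆ τ : Icc (0 : ℝ) τs, infNorm
    (mexp (S.A q) (τs - τ) * mexp (S.A p) (((k : ℝ) - 1) * τs + τ))

def gammaBar (p q : ι) (k : ℕ) : ℝ := D.deltaBar p q k + D.gammaBar' p q k

/-- `∫_τ^{τs} e^{A_q (τs - t)} B_q K_p e^{(A_p + B_p K_p)(t + (k-1) τs)} dt`. -/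
def mismatch (p q : ι) (k : ℕ) (τ : ℝ) : Matrix (Fin n) (Fin n) ℝ :=
  mint (fun t => mexp (S.A q) (τs - t) * (S.B q * D.K p) *
    mexp (D.Acl p) (t + ((k : ℝ) - 1) * τs)) τ τs

def alphaBar (p q : ι) (k : ℕ) : ℝ :=
  ⨆ τ : Icc (0 : ℝ) τs, eucNorm
    (mexp (S.A q) (τs - τ) * mexp (D.Acl p) (((k : ℝ) - 1) * τs + τ) + D.mismatch p q k τ)

/-- The two terms have the same sign, because `x' = (A_p + B_p K_p) x - B_p K_p e` before the
switch and `ξ = x - e` after it. -/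
def betaBar (p q : ι) (k : ℕ) : ℝ :=
  √n * ⨆ τ : Icc (0 : ℝ) τs, eucNorm
    (mexp (S.A q) (τs - τ) *
        mint (fun t => mexp (D.Acl p) (((k : ℝ) - 1) * τs + τ - t) * (S.B p * D.K p) *
          mexp (S.A p) t) 0 (((k : ℝ) - 1) * τs + τ)
      + D.mismatch p q k τ)

/-- The growth factor from `V_p` to `V_q` over `k` samples, the last of which sees the switch. -/
def nuBar_pq (p q : ι) (k : ℕ) : ℝ :=
  max
    (2 * (lamMax (D.P q) * D.alphaBar p q k ^ 2 + D.rho q * D.deltaBar p q k ^ 2) /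
      lamMin (D.P p))
    (2 * (lamMax (D.P q) * D.betaBar p q k ^ 2 + D.rho q * D.gammaBar p q k ^ 2) / D.rho p)

/-- `max_{p ≠ q} max_{1 ≤ k ≤ η_p}` of the growth factors. -/
def nuBar : ℝ :=
  sSup {v | ∃ p q : ι, ∃ k : ℕ, p ≠ q ∧ 1 ≤ k ∧ k ≤ S.eta τs p ∧ v = D.nuBar_pq p q k}

/-! #### The zooming-in stage -/

/-- Length (in samples) of the block that starts at sample `k` in mode `p = σ(k τs)`: the first
`i` in `[1, η_p]` with `σ((k+i-1) τs) ≠ σ((k+i) τs)`, and `η_p` if there is none. -/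
def blockLen (_D : Design S τs) (σ : ℝ → ι) (k : ℕ) : ℕ :=
  sInf ({i : ℕ | 1 ≤ i ∧ σ (((k : ℝ) + i - 1) * τs) ≠ σ (((k : ℝ) + i) * τs)} ∪
    {S.eta τs (σ (k * τs))})

/-- The samples at which blocks start, the first one being `k₀`. -/
def updateTime (σ : ℝ → ι) (k₀ : ℕ) : ℕ → ℕ
  | 0 => k₀
  | j + 1 => updateTime σ k₀ j + D.blockLen σ (updateTime σ k₀ j)

/-- One block of the zooming-in strategy, from sample `k` on: `x` is the plant state, `u` the
input, `ξ` the state estimate, `E` the error bounds and `q` the quantized outputs. -/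
structure IsBlock (σ : ℝ → ι) (x : ℝ → Fin n → ℝ) (u : ℝ → Fin m → ℝ) (ξ : ℝ → Fin n → ℝ)
    (E : ℕ → ℝ) (q : ℕ → Fin l → ℝ) (k : ℕ) : Prop where
  /-- `ξ' = (A_p + B_p K_p) ξ` inside the block, in integrated form. -/
  estimate : ∀ t ∈ Ico ((k : ℝ) * τs) ((k + D.blockLen σ k : ℕ) * τs),
    ξ t = mexp (D.Acl (σ (k * τs))) (t - k * τs) *ᵥ ξ (k * τs)
  /-- `u = K_p ξ`. -/
  input : ∀ t ∈ Ico ((k : ℝ) * τs) ((k + D.blockLen σ k : ℕ) * τs),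
    u t = D.K (σ (k * τs)) *ᵥ ξ t
  /-- Quantization of `y = C_σ x` around `C_p ξ`, with radius `‖C_p e^{A_p i τs}‖_∞ E_k`. -/
  quantize : ∀ i < D.blockLen σ k,
    IsQuantizedValue D.N
      (S.C (σ (k * τs)) *ᵥ ξ ((k + i : ℕ) * τs))
      (infNorm (S.C (σ (k * τs)) * mexp (S.A (σ (k * τs))) (i * τs)) * E k)
      (S.C (σ ((k + i : ℕ) * τs)) *ᵥ x ((k + i : ℕ) * τs))
      (q (k + i))
  /-- The bound is kept inside the block. -/
  hold : ∀ i < D.blockLen σ k, E (k + i) = E k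
  /-- No switch detected: the estimate is corrected by means of the quantized outputs. -/
  estimate_noSwitch : σ ((k + D.blockLen σ k : ℕ) * τs) = σ (k * τs) →
    ξ ((k + D.blockLen σ k : ℕ) * τs) =
      mexp (D.Acl (σ (k * τs))) (S.eta τs (σ (k * τs)) * τs) *ᵥ ξ (k * τs) +
      (mexp (S.A (σ (k * τs))) (S.eta τs (σ (k * τs)) * τs) * D.Wd (σ (k * τs))) *ᵥ
        fun a => q (k + a.1) a.2 - (S.C (σ (k * τs)) *ᵥ ξ ((k + a.1 : ℕ) * τs)) a.2
  /-- No switch detected: the bound shrinks by `θ_p`. -/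
  bound_noSwitch : σ ((k + D.blockLen σ k : ℕ) * τs) = σ (k * τs) →
    E (k + D.blockLen σ k) = D.theta (σ (k * τs)) * E k
  /-- Switch detected: the estimate is continued. -/
  estimate_switch : σ ((k + D.blockLen σ k : ℕ) * τs) ≠ σ (k * τs) →
    ξ ((k + D.blockLen σ k : ℕ) * τs) =
      mexp (D.Acl (σ (k * τs))) (D.blockLen σ k * τs) *ᵥ ξ (k * τs)
  /-- Switch detected: the new bound on the error. -/
  bound_switch : σ ((k + D.blockLen σ k : ℕ) * τs) ≠ σ (k * τs) →
    E (k + D.blockLen σ k) =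
      D.deltaBar (σ (k * τs)) (σ ((k + D.blockLen σ k : ℕ) * τs)) (D.blockLen σ k) *
          ‖ξ (k * τs)‖ +
        D.gammaBar' (σ (k * τs)) (σ ((k + D.blockLen σ k : ℕ) * τs)) (D.blockLen σ k) * E k

/-- The closed loop under the zooming-in strategy, started at sample `k₀` with an estimate
whose error is at most `E k₀` in maximum norm. -/
structure IsZoomIn (σ : ℝ → ι) (x : ℝ → Fin n → ℝ) (u : ℝ → Fin m → ℝ) (ξ : ℝ → Fin n → ℝ)
    (E : ℕ → ℝ) (q : ℕ → Fin l → ℝ) (k₀ : ℕ) : Prop where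
  plant : S.IsSolution σ u x (k₀ * τs)
  start : ‖x (k₀ * τs) - ξ (k₀ * τs)‖ ≤ E k₀
  blocks : ∀ j, D.IsBlock σ x u ξ E q (D.updateTime σ k₀ j)

/-! #### The zooming-out stage and the whole strategy -/

/-- `μ_i = e^{(1+χ) max_p ‖A_p‖_∞ i τs} μ₀`. -/
def zoomRadius (_D : Design S τs) (μ₀ χ : ℝ) (i : ℕ) : ℝ :=
  Real.exp ((1 + χ) * S.maxA * i * τs) * μ₀

/-- With `p = σ(k τs)`: at the samples `k, …, k + η_p - 1` the mode is `p` and the output is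
inside the zooming-out hypercube. -/
def Captured (μ₀ χ : ℝ) (σ : ℝ → ι) (x : ℝ → Fin n → ℝ) (k : ℕ) : Prop :=
  ∀ i < S.eta τs (σ (k * τs)),
    σ ((k + i : ℕ) * τs) = σ (k * τs) ∧
    ‖S.C (σ ((k + i : ℕ) * τs)) *ᵥ x ((k + i : ℕ) * τs)‖ ≤ D.zoomRadius μ₀ χ (k + i)

/-- The closed loop under the whole strategy from time `0`: input `0` until the first capture
`n₀, …, n₀ + η_p - 1` is complete (for ever, if there is none), then zooming in from sample
`n₀ + η_p` with estimate `0` and bound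
`e^{max_p ‖A_p‖_∞ τs} ‖e^{A_p (η_p - 1) τs}‖_∞ ‖Wd_p‖_∞ μ_{n₀ + η_p - 1}`. -/
structure IsClosedLoop (μ₀ χ : ℝ) (σ : ℝ → ι) (x : ℝ → Fin n → ℝ) (u : ℝ → Fin m → ℝ)
    (ξ : ℝ → Fin n → ℝ) (E : ℕ → ℝ) (q : ℕ → Fin l → ℝ) : Prop where
  plant : S.IsSolution σ u x 0
  zoomOut : ∀ t, 0 ≤ t →
    (∀ n₀, IsLeast {k | D.Captured μ₀ χ σ x k} n₀ →
      t < (n₀ + S.eta τs (σ (n₀ * τs)) : ℕ) * τs) → u t = 0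
  zoomIn_estimate : ∀ n₀, IsLeast {k | D.Captured μ₀ χ σ x k} n₀ →
    ξ ((n₀ + S.eta τs (σ (n₀ * τs)) : ℕ) * τs) = 0
  zoomIn_bound : ∀ n₀, IsLeast {k | D.Captured μ₀ χ σ x k} n₀ →
    E (n₀ + S.eta τs (σ (n₀ * τs))) =
      Real.exp (S.maxA * τs) *
        infNorm (mexp (S.A (σ (n₀ * τs))) (((S.eta τs (σ (n₀ * τs)) : ℝ) - 1) * τs)) *
        (infNorm (D.Wd (σ (n₀ * τs))) *
          D.zoomRadius μ₀ χ (n₀ + S.eta τs (σ (n₀ * τs)) - 1))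
  zoomIn_blocks : ∀ n₀, IsLeast {k | D.Captured μ₀ χ σ x k} n₀ → ∀ j,
    D.IsBlock σ x u ξ E q (D.updateTime σ (n₀ + S.eta τs (σ (n₀ * τs))) j)

end Design

end

/-! The strategy is examined only at the samples where blocks start, and `V` serves as a Lyapunov
function along them. The invariant is `‖x - ξ‖ ≤ E` in maximum norm. It survives a block without a
switch because the left inverse of `W_p` would recover the error exactly from unquantized outputs,
so only the quantization error, smaller by a factor `N`, remains (`IsBlock.error_noSwitch`). It
survives a block with a switch because the new bound is the worst case over all switching instants
within one sampling interval (`IsBlock.switch`).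

Given the invariant, `V` is multiplied by at most `ν < 1` over a block without a switch and by at
most `ν̄` over a block with one. A block spans at most `η` samples, so average dwell time allows at
most `N0 + J η τs / τa` switching blocks among the first `J` (`sum_le_of_averageDwellTime`). With `a
= log ν̄ ≥ 0` and a decay rate `b`, equal to `log (1/ν)` when `ν > 0`, the logarithm of the growth
of `V` over `J` blocks is at most `(a + b) · #switches - b J`. The hypothesis on `τa` says exactly
that this tends to `-∞` (`tendsto_zero_of_two_rates`). If `ν̄ < 1`, every block contracts. Between
block starts, `x` is controlled by Grönwall's inequality with a constant uniform over blocks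
(`exists_block_bound`).

For the zooming-out stage, with zero input the output grows at rate at most `max ‖A_p‖` and the
radii grow strictly faster. Since `τa > η τs`, not every window of `η` samples can contain a switch,
so a capture occurs. The captured outputs bound the state through the left inverse, which supplies
the initial error bound for zooming in (`IsClosedLoop.isZoomIn`). -/

/-! ### Matrix norms -/

section Norms

variable {α β : Type*} [Fintype α] [Fintype β] [DecidableEq β]

theorem infNorm_nonneg (M : Matrix α β ℝ) : 0 ≤ infNorm M := norm_nonneg _

theorem norm_mulVec_le_infNorm (M : Matrix α β ℝ) (v : β → ℝ) :
    ‖M *ᵥ v‖ ≤ infNorm M * ‖v‖ :=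
  (LinearMap.toContinuousLinearMap (Matrix.toLin' M)).le_opNorm v

theorem continuous_infNorm : Continuous (infNorm : Matrix α β ℝ → ℝ) :=
  (LinearMap.continuous_of_finiteDimensional
    ((Matrix.toLin' (R := ℝ) (m := α) (n := β)).trans
      LinearMap.toContinuousLinearMap).toLinearMap).norm

theorem infNorm_ne_zero {M : Matrix α β ℝ} (h : M ≠ 0) : infNorm M ≠ 0 := by
  intro h0
  apply h
  have h1 : LinearMap.toContinuousLinearMap (Matrix.toLin' M) = 0 := norm_eq_zero.1 h0
  simpa using h1

variable {n : ℕ}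

theorem eucNorm_nonneg (M : Matrix (Fin n) (Fin n) ℝ) : 0 ≤ eucNorm M := norm_nonneg _

theorem continuous_eucNorm : Continuous (eucNorm : Matrix (Fin n) (Fin n) ℝ → ℝ) :=
  (LinearMap.continuous_of_finiteDimensional
    ((Matrix.toEuclideanLin (𝕜 := ℝ) (m := Fin n) (n := Fin n)).trans
      LinearMap.toContinuousLinearMap).toLinearMap).norm

/-- The Euclidean norm of a vector. -/
noncomputable def vecNorm (v : Fin n → ℝ) : ℝ := ‖WithLp.toLp 2 v‖

theorem vecNorm_nonneg (v : Fin n → ℝ) : 0 ≤ vecNorm v := norm_nonneg _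

theorem vecNorm_sq (v : Fin n → ℝ) : vecNorm v ^ 2 = v ⬝ᵥ v := by
  rw [vecNorm, EuclideanSpace.norm_sq_eq]
  simp [dotProduct, pow_two]

theorem vecNorm_mulVec_le (M : Matrix (Fin n) (Fin n) ℝ) (v : Fin n → ℝ) :
    vecNorm (M *ᵥ v) ≤ eucNorm M * vecNorm v := by
  have h := (LinearMap.toContinuousLinearMap (Matrix.toEuclideanLin M)).le_opNorm
    (WithLp.toLp 2 v)
  simpa [vecNorm, eucNorm, Matrix.toLpLin_toLp] using h

theorem vecNorm_sub_le (v w : Fin n → ℝ) : vecNorm (v - w) ≤ vecNorm v + vecNorm w := by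
  simpa [vecNorm] using norm_sub_le (WithLp.toLp 2 v) (WithLp.toLp 2 w)

theorem abs_dotProduct_le (v w : Fin n → ℝ) : |v ⬝ᵥ w| ≤ vecNorm v * vecNorm w := by
  have h := abs_real_inner_le_norm (WithLp.toLp 2 w) (WithLp.toLp 2 v)
  rw [EuclideanSpace.inner_toLp_toLp] at h
  simpa [vecNorm, mul_comm] using h

theorem norm_le_vecNorm (v : Fin n → ℝ) : ‖v‖ ≤ vecNorm v := by
  rw [pi_norm_le_iff_of_nonneg (vecNorm_nonneg v)]
  intro i
  exact PiLp.norm_apply_le (WithLp.toLp 2 v) i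

theorem vecNorm_sq_le (v : Fin n → ℝ) : vecNorm v ^ 2 ≤ n * ‖v‖ ^ 2 := by
  rw [vecNorm_sq]
  calc v ⬝ᵥ v = ∑ i, v i * v i := rfl
    _ ≤ ∑ _i : Fin n, ‖v‖ ^ 2 := by
        refine Finset.sum_le_sum fun i _ => ?_
        have h := norm_le_pi_norm v i
        rw [Real.norm_eq_abs] at h
        nlinarith [abs_nonneg (v i), abs_mul_abs_self (v i)]
    _ = n * ‖v‖ ^ 2 := by simp

theorem vecNorm_le (v : Fin n → ℝ) : vecNorm v ≤ √n * ‖v‖ := by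
  rw [← Real.sqrt_sq (norm_nonneg v), ← Real.sqrt_mul (Nat.cast_nonneg n)]
  exact Real.le_sqrt_of_sq_le (vecNorm_sq_le v)

end Norms

/-! ### Extreme eigenvalues -/

section Eigenvalues

variable {n : ℕ} {P : Matrix (Fin n) (Fin n) ℝ}

theorem Matrix.IsHermitian.finite_spectrum (hP : P.IsHermitian) : (spectrum ℝ P).Finite := by
  rw [hP.spectrum_real_eq_range_eigenvalues]
  exact finite_range _

theorem Matrix.IsHermitian.posSemidef_of_spectrum (hP : P.IsHermitian)
    (h : ∀ c ∈ spectrum ℝ P, 0 ≤ c) : P.PosSemidef := by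
  rw [hP.posSemidef_iff_eigenvalues_nonneg]
  intro i
  apply h
  rw [hP.spectrum_real_eq_range_eigenvalues]
  exact mem_range_self i

/-- Subtracting `lamMin P` times the identity shifts the spectrum into `[0, ∞)`, so the difference
is positive semidefinite. -/
theorem lamMin_mul_le (hP : P.IsHermitian) (v : Fin n → ℝ) :
    lamMin P * vecNorm v ^ 2 ≤ v ⬝ᵥ (P *ᵥ v) := by
  have hs : (P - algebraMap ℝ _ (lamMin P)).IsHermitian :=
    hP.sub (by simp [Matrix.IsHermitian, Matrix.algebraMap_eq_diagonal])
  have h := (hs.posSemidef_of_spectrum fun c hc => by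
    rw [← spectrum.sub_singleton_eq] at hc
    obtain ⟨a, ha, b, rfl, rfl⟩ := hc
    have : lamMin P ≤ a := csInf_le hP.finite_spectrum.bddBelow ha
    simpa using this).dotProduct_mulVec_nonneg v
  have h2 : algebraMap ℝ (Matrix (Fin n) (Fin n) ℝ) (lamMin P) *ᵥ v = lamMin P • v := by
    rw [Algebra.algebraMap_eq_smul_one, Matrix.smul_mulVec, Matrix.one_mulVec]
  rw [Matrix.sub_mulVec, h2, star_trivial, dotProduct_sub, dotProduct_smul, ← vecNorm_sq] at h
  simpa using h

theorem le_lamMax_mul (hP : P.IsHermitian) (v : Fin n → ℝ) :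
    v ⬝ᵥ (P *ᵥ v) ≤ lamMax P * vecNorm v ^ 2 := by
  have hs : (algebraMap ℝ _ (lamMax P) - P).IsHermitian :=
    Matrix.IsHermitian.sub (by simp [Matrix.IsHermitian, Matrix.algebraMap_eq_diagonal]) hP
  have h := (hs.posSemidef_of_spectrum fun c hc => by
    rw [← spectrum.singleton_sub_eq] at hc
    obtain ⟨b, rfl, a, ha, rfl⟩ := hc
    have : a ≤ lamMax P := le_csSup hP.finite_spectrum.bddAbove ha
    simpa using this).dotProduct_mulVec_nonneg v
  have h2 : algebraMap ℝ (Matrix (Fin n) (Fin n) ℝ) (lamMax P) *ᵥ v = lamMax P • v := by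
    rw [Algebra.algebraMap_eq_smul_one, Matrix.smul_mulVec, Matrix.one_mulVec]
  rw [Matrix.sub_mulVec, h2, star_trivial, dotProduct_sub, dotProduct_smul, ← vecNorm_sq] at h
  simpa using h

theorem Matrix.PosDef.lamMin_pos (hn : 1 ≤ n) (hP : P.PosDef) : 0 < lamMin P := by
  have hne : (spectrum ℝ P).Nonempty := by
    rw [hP.isHermitian.spectrum_real_eq_range_eigenvalues]
    exact ⟨_, mem_range_self ⟨0, hn⟩⟩
  have hm : lamMin P ∈ spectrum ℝ P := hne.csInf_mem hP.isHermitian.finite_spectrum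
  rw [hP.isHermitian.spectrum_real_eq_range_eigenvalues] at hm
  obtain ⟨i, hi⟩ := hm
  rw [← hi]
  exact hP.eigenvalues_pos i

theorem Matrix.PosDef.lamMax_pos (hn : 1 ≤ n) (hP : P.PosDef) : 0 < lamMax P := by
  refine (hP.eigenvalues_pos ⟨0, hn⟩).trans_le
    (le_csSup hP.isHermitian.finite_spectrum.bddAbove ?_)
  rw [hP.isHermitian.spectrum_real_eq_range_eigenvalues]
  exact mem_range_self _

end Eigenvalues

/-! ### The matrix exponential and variation of constants -/

section Exponential

variable {n : ℕ}

@[simp] theorem mexp_zero (M : Matrix (Fin n) (Fin n) ℝ) : mexp M 0 = 1 := by simp [mexp]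

open scoped Matrix.Norms.Operator in
theorem hasDerivAt_mexp (M : Matrix (Fin n) (Fin n) ℝ) (t : ℝ) (i j : Fin n) :
    HasDerivAt (fun s => mexp M s i j) ((M * mexp M t) i j) t := by
  have h : HasDerivAt (fun s : ℝ => NormedSpace.exp (s • M)) (M * NormedSpace.exp (t • M)) t :=
    hasDerivAt_exp_smul_const' M t
  exact hasDerivAt_pi.1 (hasDerivAt_pi.1 h i) j

open scoped Matrix.Norms.Operator in
theorem hasDerivAt_mexp' (M : Matrix (Fin n) (Fin n) ℝ) (t : ℝ) (i j : Fin n) :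
    HasDerivAt (fun s => mexp M s i j) ((mexp M t * M) i j) t := by
  have h : HasDerivAt (fun s : ℝ => NormedSpace.exp (s • M)) (NormedSpace.exp (t • M) * M) t :=
    hasDerivAt_exp_smul_const M t
  exact hasDerivAt_pi.1 (hasDerivAt_pi.1 h i) j

@[fun_prop]
theorem continuous_mexp (M : Matrix (Fin n) (Fin n) ℝ) : Continuous (mexp M) :=
  continuous_matrix fun i j =>
    continuous_iff_continuousAt.2 fun t => (hasDerivAt_mexp M t i j).continuousAt

theorem hasDerivWithinAt_mulVec {a b : ℕ} {F : ℝ → Matrix (Fin a) (Fin b) ℝ}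
    {F' : Matrix (Fin a) (Fin b) ℝ} {x : ℝ → Fin b → ℝ} {x' : Fin b → ℝ} {s : Set ℝ} {t : ℝ}
    (hF : ∀ i j, HasDerivWithinAt (fun r => F r i j) (F' i j) s t)
    (hx : HasDerivWithinAt x x' s t) :
    HasDerivWithinAt (fun r => F r *ᵥ x r) (F' *ᵥ x t + F t *ᵥ x') s t := by
  rw [hasDerivWithinAt_pi] at hx ⊢
  intro i
  have h := HasDerivWithinAt.fun_sum (u := Finset.univ) fun j _ => (hF i j).mul (hx j)
  simpa [Matrix.mulVec, dotProduct, Finset.sum_add_distrib] using h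

theorem hasDerivAt_mexp_mulVec (M : Matrix (Fin n) (Fin n) ℝ) (v : Fin n → ℝ) (c t : ℝ) :
    HasDerivAt (fun s => mexp M (s - c) *ᵥ v) (M *ᵥ (mexp M (t - c) *ᵥ v)) t := by
  rw [← hasDerivWithinAt_univ]
  have h := hasDerivWithinAt_mulVec (x := fun _ => v) (x' := 0) (s := univ) (t := t)
    (F := fun s => mexp M (s - c)) (F' := M * mexp M (t - c))
    (fun i j => ((hasDerivAt_mexp M (t - c) i j).comp_sub_const t c).hasDerivWithinAt)
    (hasDerivWithinAt_const ..)
  simpa [Matrix.mulVec_mulVec] using h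

theorem mint_mulVec {F : ℝ → Matrix (Fin n) (Fin n) ℝ} (hF : Continuous F) (a b : ℝ)
    (v : Fin n → ℝ) (i : Fin n) : (mint F a b *ᵥ v) i = ∫ t in a..b, (F t *ᵥ v) i := by
  simp only [mint, Matrix.mulVec, dotProduct, Matrix.of_apply]
  rw [intervalIntegral.integral_finsetSum]
  · simp
  · intro j _
    exact ((hF.matrix_elem i j).mul continuous_const).intervalIntegrable _ _

theorem mint_comp_add (F : ℝ → Matrix (Fin n) (Fin n) ℝ) (a b c : ℝ) :
    mint F (a + c) (b + c) = mint (fun t => F (t + c)) a b := by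
  ext i j
  simp only [mint, Matrix.of_apply]
  rw [intervalIntegral.integral_comp_add_right fun t => F t i j]

theorem continuous_mint_left {F : ℝ → Matrix (Fin n) (Fin n) ℝ} (hF : Continuous F) (b : ℝ) :
    Continuous fun a => mint F a b := by
  refine continuous_matrix fun i j => ?_
  simp only [mint, Matrix.of_apply]
  simp_rw [fun a => intervalIntegral.integral_symm (f := fun t => F t i j) (μ := MeasureTheory.volume) b a]
  exact (intervalIntegral.continuous_primitive
    (fun _ _ => (hF.matrix_elem i j).intervalIntegrable _ _) b).neg

/-- Variation of constants, for a right-differentiable solution. -/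
theorem variation_of_constants {A : Matrix (Fin n) (Fin n) ℝ} {G : ℝ → Matrix (Fin n) (Fin n) ℝ}
    (hG : Continuous G) {x : ℝ → Fin n → ℝ} {v : Fin n → ℝ} {a b : ℝ} (hab : a ≤ b)
    (hc : ContinuousOn x (Icc a b))
    (hx : ∀ t ∈ Ico a b, HasDerivWithinAt x (A *ᵥ x t + G t *ᵥ v) (Ici t) t) :
    x b = mexp A (b - a) *ᵥ x a + mint (fun t => mexp A (b - t) * G t) a b *ᵥ v := by
  have hcont : Continuous fun t => mexp A (b - t) * G t := by fun_prop
  -- Differentiating `e^{A(b-s)} x(s)` cancels the term `A x` and leaves only the forcing. The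
  -- fundamental theorem of calculus for right derivatives then suffices.
  have hd : ∀ t ∈ Ico a b, HasDerivWithinAt (fun s => mexp A (b - s) *ᵥ x s)
      ((mexp A (b - t) * G t) *ᵥ v) (Ici t) t := by
    intro t ht
    have h := hasDerivWithinAt_mulVec (F := fun s => mexp A (b - s))
      (F' := -(mexp A (b - t) * A)) (s := Ici t) (t := t)
      (fun i j => ((hasDerivAt_mexp' A (b - t) i j).comp_const_sub b t).hasDerivWithinAt)
      (hx t ht)
    convert h using 1
    simp [Matrix.neg_mulVec, Matrix.mulVec_add, Matrix.mulVec_mulVec]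
  have hC : ContinuousOn (fun s => mexp A (b - s) *ᵥ x s) (Icc a b) := by
    rw [continuousOn_iff_continuous_domRestrict] at hc ⊢
    have : Continuous fun s : Icc a b => mexp A (b - s) := by fun_prop
    exact this.matrix_mulVec hc
  ext i
  rw [Pi.add_apply, mint_mulVec hcont]
  have := intervalIntegral.integral_eq_sub_of_hasDeriv_right_of_le hab
    ((continuous_apply i).comp_continuousOn hC)
    (fun t ht => ((hasDerivWithinAt_pi.1 (hd t ⟨ht.1.le, ht.2⟩) i).mono Ioi_subset_Ici_self))
    (Continuous.intervalIntegrable 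
      ((continuous_apply i).comp (hcont.matrix_mulVec continuous_const)) a b)
  simp only [Function.comp_apply] at this
  rw [this]
  simp

/-- The integrand is the derivative of `-e^{(A+M)(T-t)} e^{At}`. With `M = B_p K_p` this gives
closed forms for `Bbar` and for the integral in `betaBar`, so the state can be computed from the
error without a second variation of constants. -/
theorem mint_mexp_sub (M A : Matrix (Fin n) (Fin n) ℝ) (T : ℝ) :
    mint (fun t => mexp (A + M) (T - t) * M * mexp A t) 0 T = mexp (A + M) T - mexp A T := by
  have hcont : Continuous fun t => mexp (A + M) (T - t) * M * mexp A t := by fun_prop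
  ext i j
  simp only [mint, Matrix.of_apply]
  have h : ∀ t, HasDerivAt (fun s => -(mexp (A + M) (T - s) * mexp A s) i j)
      ((mexp (A + M) (T - t) * M * mexp A t) i j) t := by
    intro t
    have h := (HasDerivAt.fun_sum (u := Finset.univ) fun k _ =>
      ((hasDerivAt_mexp' (A + M) (T - t) i k).comp_const_sub T t).mul
        (hasDerivAt_mexp A t k j)).fun_neg
    have : mexp (A + M) (T - t) * M * mexp A t =
      -(-(mexp (A + M) (T - t) * (A + M)) * mexp A t + mexp (A + M) (T - t) * (A * mexp A t)) := by
      noncomm_ring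
    rw [this]
    simpa [Matrix.mul_apply, Finset.sum_add_distrib, Finset.sum_neg_distrib] using h
  rw [intervalIntegral.integral_eq_sub_of_hasDerivAt (fun t _ => h t)
    ((hcont.matrix_elem i j).intervalIntegrable _ _)]
  simp
  ring

end Exponential

/-! ### Switching signals -/

section SwitchingSignals

variable {ι : Type*} {σ : ℝ → ι} {τs : ℝ}

theorem IsSwitchingSignal.finite_inter_Ioc (hσ : IsSwitchingSignal σ) (a b : ℝ) :
    (switchTimes σ ∩ Ioc a b).Finite :=
  (hσ.finite b).subset fun _ h => ⟨h.1, h.2.2⟩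

/-- Continuous induction on `[a, b]`: the set where `σ` equals `σ a` is closed because `σ` is
locally constant at every point of `(a, b]`, and it extends to the right by right-continuity. -/
theorem IsSwitchingSignal.eqOn_of_no_switch (hσ : IsSwitchingSignal σ) {a b : ℝ} (ha : 0 ≤ a)
    (h : switchTimes σ ∩ Ioc a b = ∅) : ∀ t ∈ Icc a b, σ t = σ a := by
  refine IsClosed.Icc_subset_of_forall_mem_nhdsWithin (s := {t | σ t = σ a}) ?_ rfl ?_
  · rw [← closure_subset_iff_isClosed]
    intro T hT
    have hTI : T ∈ Icc a b :=
      closure_minimal inter_subset_right isClosed_Icc hT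
    refine ⟨?_, hTI⟩
    rcases hTI.1.eq_or_lt with rfl | haT
    · rfl
    have hns : ∀ᶠ t in 𝓝 T, σ t = σ T := by
      by_contra hcon
      have : T ∈ switchTimes σ ∩ Ioc a b := ⟨⟨ha.trans_lt haT, hcon⟩, haT, hTI.2⟩
      rw [h] at this
      exact this
    obtain ⟨t, h1, h2⟩ := ((mem_closure_iff_frequently.1 hT).and_eventually hns).exists
    exact h2.symm.trans h1.1
  · rintro x ⟨hx, hxI⟩
    filter_upwards [hσ.rightCont x (ha.trans hxI.1)] with s hs
    exact hs.trans hx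

theorem IsSwitchingSignal.one_le_numSwitches (hσ : IsSwitchingSignal σ) {a b : ℝ} (ha : 0 ≤ a)
    (hab : a ≤ b) (h : σ b ≠ σ a) : 1 ≤ numSwitches σ b a := by
  rw [numSwitches, Nat.one_le_iff_ne_zero, Ne, ncard_eq_zero (hσ.finite_inter_Ioc a b)]
  intro h0
  exact h (hσ.eqOn_of_no_switch ha h0 b ⟨hab, le_rfl⟩)

theorem IsSwitchingSignal.numSwitches_add (hσ : IsSwitchingSignal σ) {a b c : ℝ} (hab : a ≤ b)
    (hbc : b ≤ c) : numSwitches σ b a + numSwitches σ c b = numSwitches σ c a := by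
  unfold numSwitches
  rw [← ncard_union_eq _ (hσ.finite_inter_Ioc a b) (hσ.finite_inter_Ioc b c),
    ← inter_union_distrib_left, Ioc_union_Ioc_eq_Ioc hab hbc]
  rw [disjoint_left]
  rintro t ⟨_, h1⟩ ⟨_, h2⟩
  exact absurd h1.2 (not_le.2 h2.1)

theorem IsSwitchingSignal.exists_switch (hσ : IsSwitchingSignal σ) {a b : ℝ} (ha : 0 ≤ a)
    (hab : a < b) (h1 : numSwitches σ b a ≤ 1) :
    ∃ T ∈ Ioc a b, (∀ t ∈ Ico a T, σ t = σ a) ∧ ∀ t ∈ Icc T b, σ t = σ b := by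
  rcases eq_empty_or_nonempty (switchTimes σ ∩ Ioc a b) with h0 | ⟨T, hT⟩
  · have h := hσ.eqOn_of_no_switch ha h0
    -- Without a switch, `T = b` serves: the second interval is a single point.
    refine ⟨b, ⟨hab, le_rfl⟩, fun t ht => h t ⟨ht.1, ht.2.le⟩, fun t ht => ?_⟩
    rw [le_antisymm ht.2 ht.1]
  · have hu : ∀ T' ∈ switchTimes σ ∩ Ioc a b, T' = T := fun T' hT' =>
      (ncard_le_one (hσ.finite_inter_Ioc a b)).1 h1 T' hT' T hT
    refine ⟨T, hT.2, fun t ht => ?_, fun t ht => ?_⟩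
    · refine hσ.eqOn_of_no_switch (b := t) ha ?_ t ⟨ht.1, le_rfl⟩
      rw [eq_empty_iff_forall_notMem]
      rintro s ⟨hs, hs1, hs2⟩
      have := hu s ⟨hs, hs1, hs2.trans (ht.2.le.trans hT.2.2)⟩
      exact absurd (hs2.trans_lt ht.2) (by rw [this]; exact lt_irrefl _)
    · have h := hσ.eqOn_of_no_switch (a := T) (b := b) hT.1.1.le (by
        rw [eq_empty_iff_forall_notMem]
        rintro s ⟨hs, hs1, hs2⟩
        exact hs1.ne' (hu s ⟨hs, hT.2.1.trans hs1, hs2⟩))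
      rw [h t ht, h b ⟨hT.2.2, le_rfl⟩]

/-- This is where the dwell time matters: with at most one switch, the signal cannot leave a mode
and come back between two samples, so comparing modes at samples detects every switch. -/
theorem IsSwitchingSignal.eqOn_of_eq (hσ : IsSwitchingSignal σ) {a b : ℝ} (ha : 0 ≤ a)
    (hab : a < b) (h1 : numSwitches σ b a ≤ 1) (h : σ b = σ a) : ∀ t ∈ Icc a b, σ t = σ a := by
  obtain ⟨T, hT, hl, hr⟩ := hσ.exists_switch ha hab h1
  intro t ht
  rcases lt_or_ge t T with h2 | h2
  · exact hl t ⟨ht.1, h2⟩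
  · rw [hr t ⟨h2, ht.2⟩, h]

theorem IsSwitchingSignal.eqOn_of_samples (hσ : IsSwitchingSignal σ) (hτs : 0 < τs)
    (hdwell : HasDwellTime σ τs) (k L : ℕ) (h : ∀ i ≤ L, σ ((k + i : ℕ) * τs) = σ (k * τs)) :
    ∀ t ∈ Icc (k * τs) ((k + L : ℕ) * τs), σ t = σ (k * τs) := by
  induction L with
  | zero =>
    intro t ht
    rw [le_antisymm ht.2 ht.1, add_zero]
  | succ L ih =>
    intro t ht
    rcases le_total t ((k + L : ℕ) * τs) with h1 | h1
    · exact ih (fun i hi => h i (hi.trans L.le_succ)) t ⟨ht.1, h1⟩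
    · have hlen : ((k + (L + 1) : ℕ) : ℝ) * τs - ((k + L : ℕ) : ℝ) * τs = τs := by
        push_cast; ring
      rw [hσ.eqOn_of_eq (by positivity) (by linarith)
        (hdwell _ _ (by positivity) (by linarith) hlen.le)
        ((h _ le_rfl).trans (h L L.le_succ).symm) t ⟨h1, ht.2⟩, h L L.le_succ]

/-- Between samples `a` and `b` with intermediate marked pairs of samples of different modes, there
are at least as many switches as marks. -/
theorem IsSwitchingSignal.sum_le_numSwitches (hσ : IsSwitchingSignal σ) (hτs : 0 < τs)
    {r : ℕ → ℕ} (hr : Monotone r) {s : ℕ → ℕ} (hs : ∀ j, s j ≤ 1)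
    (h : ∀ j, s j ≠ 0 → 1 ≤ numSwitches σ (r (j + 1) * τs) (r j * τs)) (J : ℕ) :
    ∑ j ∈ Finset.range J, s j ≤ numSwitches σ (r J * τs) (r 0 * τs) := by
  induction J with
  | zero => simp
  | succ J ih =>
    rw [Finset.sum_range_succ, ← hσ.numSwitches_add (b := r J * τs)
      (by gcongr; exact hr (Nat.zero_le _)) (by gcongr; exact hr J.le_succ)]
    refine add_le_add ih ?_
    by_cases h0 : s J = 0
    · simp [h0]
    · exact (hs J).trans (h J h0)

theorem sum_le_of_averageDwellTime (hσ : IsSwitchingSignal σ) (hτs : 0 < τs)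
    {τa : ℝ} (hτa : 0 < τa) {N0 : ℕ} (hadt : HasAverageDwellTime σ τa N0)
    {r : ℕ → ℕ} (hr : Monotone r) {η : ℕ} (hη : ∀ j, r (j + 1) ≤ r j + η)
    {s : ℕ → ℕ} (hs : ∀ j, s j ≤ 1)
    (h : ∀ j, s j ≠ 0 → 1 ≤ numSwitches σ (r (j + 1) * τs) (r j * τs)) (J : ℕ) :
    ((∑ j ∈ Finset.range J, s j : ℕ) : ℝ) ≤ N0 + J * (η * τs / τa) := by
  have hJ : r J ≤ r 0 + J * η := by
    induction J with
    | zero => simp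
    | succ J ih => have := hη J; rw [Nat.succ_mul]; omega
  have h0 : r 0 ≤ r J := hr (Nat.zero_le _)
  have hJ' : (r J : ℝ) ≤ r 0 + J * η := by exact_mod_cast hJ
  have h1 : ((∑ j ∈ Finset.range J, s j : ℕ) : ℝ) ≤ numSwitches σ (r J * τs) (r 0 * τs) := by
    exact_mod_cast hσ.sum_le_numSwitches hτs hr hs h J
  refine h1.trans ?_
  -- The average dwell-time bound is only available on intervals of positive length.
  rcases h0.eq_or_lt with he | hlt
  · rw [← he]
    simp only [numSwitches, Ioc_self, inter_empty, ncard_empty]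
    push_cast
    positivity
  · refine (hadt (r 0 * τs) (r J * τs) (by positivity) (by gcongr)).trans ?_
    have : (r J * τs - r 0 * τs) / τa ≤ J * (η * τs / τa) := by
      rw [← mul_div_assoc]
      gcongr
      nlinarith
    linarith

end SwitchingSignals

/-! ### Blocks -/

namespace Design

variable {ι : Type*} {n m l : ℕ} {S : SwitchedSystem ι n m l} {τs : ℝ} {D : Design S τs}

/-- With zero block rows, the product of the left inverse and `W_p` would be `0`, not the identity
of size `n ≥ 1`. This also rules out the default value `0` of `sInf ∅`. -/
theorem IsAdmissible.one_le_eta (hD : D.IsAdmissible) (hn : 1 ≤ n) (p : ι) :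
    1 ≤ S.eta τs p := by
  rw [Nat.one_le_iff_ne_zero]
  intro h0
  have h := congrFun (congrFun (hD.leftInverse p) ⟨0, hn⟩) ⟨0, hn⟩
  have : IsEmpty (Fin (S.eta τs p)) := by rw [h0]; infer_instance
  simp [Matrix.mul_apply] at h

theorem blockLen_le (D : Design S τs) (σ : ℝ → ι) (k : ℕ) :
    D.blockLen σ k ≤ S.eta τs (σ (k * τs)) :=
  Nat.sInf_le (Or.inr rfl)

theorem blockLen_mem (D : Design S τs) (σ : ℝ → ι) (k : ℕ) :
    (1 ≤ D.blockLen σ k ∧ σ (((k : ℝ) + D.blockLen σ k - 1) * τs) ≠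
      σ (((k : ℝ) + D.blockLen σ k) * τs)) ∨ D.blockLen σ k = S.eta τs (σ (k * τs)) :=
  Nat.sInf_mem (s := {i : ℕ | 1 ≤ i ∧ σ (((k : ℝ) + i - 1) * τs) ≠ σ (((k : ℝ) + i) * τs)} ∪
    {S.eta τs (σ (k * τs))}) ⟨_, Or.inr rfl⟩

theorem IsAdmissible.one_le_blockLen (hD : D.IsAdmissible) (hn : 1 ≤ n) (σ : ℝ → ι) (k : ℕ) :
    1 ≤ D.blockLen σ k := by
  rcases D.blockLen_mem σ k with h | h
  · exact h.1
  · rw [h]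
    exact hD.one_le_eta hn _

theorem mode_of_lt_blockLen (D : Design S τs) (σ : ℝ → ι) (k i : ℕ) (hi : i < D.blockLen σ k) :
    σ ((k + i : ℕ) * τs) = σ (k * τs) := by
  induction i with
  | zero => simp
  | succ i ih =>
    have h := Nat.notMem_of_lt_sInf hi
    simp only [mem_union, not_or, mem_ofPred_eq, not_and, not_not] at h
    have h1 := h.1 (by omega)
    rw [← ih (by omega), show (((k + (i + 1) : ℕ)) : ℝ) = (k : ℝ) + ((i + 1 : ℕ) : ℝ) by
      push_cast; ring, ← h1]
    congr 1
    push_cast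
    ring

/-- A block cut short by a mode change still has mode `p` at its last interior sample, by
minimality, so its end sample would have a different mode. -/
theorem blockLen_eq_eta (D : Design S τs) (σ : ℝ → ι) (k : ℕ)
    (h : σ ((k + D.blockLen σ k : ℕ) * τs) = σ (k * τs)) :
    D.blockLen σ k = S.eta τs (σ (k * τs)) := by
  rcases D.blockLen_mem σ k with h1 | h1
  · exfalso
    apply h1.2
    have h2 := D.mode_of_lt_blockLen σ k (D.blockLen σ k - 1) (by omega)
    push_cast [Nat.cast_sub h1.1] at h h2
    rw [h, ← h2]
    congr 1
    ring
  · exact h1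

end Design

/-! ### Suprema over a sampling interval and quadratic-form inequalities -/

theorem le_iSup_Icc {a b : ℝ} {f : ℝ → ℝ} (hf : Continuous f) {τ : ℝ} (hτ : τ ∈ Icc a b) :
    f τ ≤ ⨆ s : Icc a b, f s := by
  -- Compactness is essential: the supremum of an unbounded family of reals is `0` by default.
  have hbdd : BddAbove (range fun s : Icc a b => f s) :=
    (isCompact_range (hf.comp continuous_subtype_val)).bddAbove
  exact le_ciSup hbdd ⟨τ, hτ⟩

theorem quadratic_form_sub {n : ℕ} {P : Matrix (Fin n) (Fin n) ℝ} (hP : Pᵀ = P)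
    (M N : Matrix (Fin n) (Fin n) ℝ) (v w : Fin n → ℝ) :
    (M *ᵥ v - N *ᵥ w) ⬝ᵥ (P *ᵥ (M *ᵥ v - N *ᵥ w)) =
      v ⬝ᵥ ((Mᵀ * P * M) *ᵥ v) - 2 * (v ⬝ᵥ ((Mᵀ * P * N) *ᵥ w)) + w ⬝ᵥ ((Nᵀ * P * N) *ᵥ w) := by
  have key : ∀ (X Y : Matrix (Fin n) (Fin n) ℝ) (a b : Fin n → ℝ),
      (X *ᵥ a) ⬝ᵥ (P *ᵥ (Y *ᵥ b)) = a ⬝ᵥ ((Xᵀ * P * Y) *ᵥ b) := by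
    intro X Y a b
    rw [← Matrix.mulVec_mulVec, ← Matrix.mulVec_mulVec, Matrix.dotProduct_mulVec a Xᵀ,
      Matrix.vecMul_transpose]
  have hsymm : w ⬝ᵥ ((Nᵀ * P * M) *ᵥ v) = v ⬝ᵥ ((Mᵀ * P * N) *ᵥ w) := by
    rw [Matrix.dotProduct_mulVec, ← Matrix.mulVec_transpose, dotProduct_comm]
    congr 2
    simp [Matrix.transpose_mul, hP, Matrix.mul_assoc]
  simp only [Matrix.mulVec_sub, sub_dotProduct, dotProduct_sub, key, hsymm]
  ring

theorem two_mul_le_young {a b c s : ℝ} (hs : 0 < s) :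
    2 * (a * (c * b)) ≤ s * a ^ 2 + c ^ 2 / s * b ^ 2 := by
  have h : s * a ^ 2 + c ^ 2 / s * b ^ 2 - 2 * (a * (c * b)) = (s * a - c * b) ^ 2 / s := by
    field_simp
    ring
  have : 0 ≤ (s * a - c * b) ^ 2 / s := by positivity
  linarith

namespace Design

variable {ι : Type*} {n m l : ℕ} {S : SwitchedSystem ι n m l} {τs : ℝ} {D : Design S τs}

/-! ### Bounds by the constants of the design -/

theorem infNorm_le_deltaBar (D : Design S τs) (p q : ι) (k : ℕ) {τ : ℝ} (hτ : τ ∈ Icc 0 τs) :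
    infNorm (mint (fun t => mexp (S.A q) (τs - t) * D.H p q *
      mexp (D.Acl p) (t + ((k : ℝ) - 1) * τs)) τ τs) ≤ D.deltaBar p q k :=
  le_iSup_Icc (continuous_infNorm.comp (continuous_mint_left (by fun_prop) _)) hτ

theorem infNorm_le_gammaBar' (D : Design S τs) (p q : ι) (k : ℕ) {τ : ℝ} (hτ : τ ∈ Icc 0 τs) :
    infNorm (mexp (S.A q) (τs - τ) * mexp (S.A p) (((k : ℝ) - 1) * τs + τ)) ≤
      D.gammaBar' p q k :=
  le_iSup_Icc (f := fun τ => infNorm (mexp (S.A q) (τs - τ) *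
    mexp (S.A p) (((k : ℝ) - 1) * τs + τ))) (continuous_infNorm.comp (by fun_prop)) hτ

theorem continuous_mismatch (D : Design S τs) (p q : ι) (k : ℕ) :
    Continuous (D.mismatch p q k) :=
  continuous_mint_left (by fun_prop) _

theorem eucNorm_le_alphaBar (D : Design S τs) (p q : ι) (k : ℕ) {τ : ℝ} (hτ : τ ∈ Icc 0 τs) :
    eucNorm (mexp (S.A q) (τs - τ) * mexp (D.Acl p) (((k : ℝ) - 1) * τs + τ) +
      D.mismatch p q k τ) ≤ D.alphaBar p q k := by
  have h := D.continuous_mismatch p q k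
  exact le_iSup_Icc (f := fun τ => eucNorm (mexp (S.A q) (τs - τ) *
    mexp (D.Acl p) (((k : ℝ) - 1) * τs + τ) + D.mismatch p q k τ))
    (continuous_eucNorm.comp (by fun_prop)) hτ

theorem eucNorm_le_betaBar (D : Design S τs) (p q : ι) (k : ℕ) {τ : ℝ} (hτ : τ ∈ Icc 0 τs) :
    √n * eucNorm (mexp (S.A q) (τs - τ) * (mexp (D.Acl p) (((k : ℝ) - 1) * τs + τ) -
      mexp (S.A p) (((k : ℝ) - 1) * τs + τ)) + D.mismatch p q k τ) ≤ D.betaBar p q k := by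
  have h := D.continuous_mismatch p q k
  have h2 := le_iSup_Icc (f := fun τ => eucNorm (mexp (S.A q) (τs - τ) *
    (mexp (D.Acl p) (((k : ℝ) - 1) * τs + τ) -
      mexp (S.A p) (((k : ℝ) - 1) * τs + τ)) + D.mismatch p q k τ))
    (continuous_eucNorm.comp (by fun_prop)) hτ
  unfold betaBar
  simp_rw [Acl, mint_mexp_sub]
  exact mul_le_mul_of_nonneg_left h2 (Real.sqrt_nonneg _)

theorem nuBar_pq_le_nuBar [Finite ι] (D : Design S τs) {p q : ι} (hpq : p ≠ q) {k : ℕ}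
    (hk : 1 ≤ k) (hk' : k ≤ S.eta τs p) : D.nuBar_pq p q k ≤ D.nuBar := by
  refine le_csSup (Set.Finite.bddAbove ?_) ⟨p, q, k, hpq, hk, hk', rfl⟩
  -- The set of factors is finite because `k` is bounded by the largest `η_p`, so its `sSup` is a
  -- true maximum when it is nonempty.
  refine (finite_range fun z : ι × ι × Fin ((⨆ p, S.eta τs p) + 1) =>
    D.nuBar_pq z.1 z.2.1 z.2.2).subset ?_
  rintro _ ⟨p, q, k, -, -, hk, rfl⟩
  have : S.eta τs p ≤ ⨆ p, S.eta τs p := le_ciSup (Finite.bddAbove_range _) p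
  exact ⟨(p, q, ⟨k, by omega⟩), rfl⟩

theorem nu_p_le_nu [Finite ι] (D : Design S τs) (p : ι) : D.nu_p p ≤ D.nu :=
  le_ciSup (Finite.bddAbove_range _) p

theorem theta_nonneg (D : Design S τs) (p : ι) : 0 ≤ D.theta p := by
  unfold theta rate
  exact div_nonneg (mul_nonneg (infNorm_nonneg _)
    (Real.iSup_nonneg fun _ => infNorm_nonneg _)) (Nat.cast_nonneg _)

theorem IsAdmissible.N_pos (hD : D.IsAdmissible) : (0 : ℝ) < D.N := by
  exact_mod_cast hD.odd.pos

theorem IsAdmissible.theta_lt_one (hD : D.IsAdmissible) (p : ι) : D.theta p < 1 :=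
  (div_lt_one hD.N_pos).2 (hD.dataRate p)

theorem IsAdmissible.beta_nonneg (hD : D.IsAdmissible) (hn : 1 ≤ n) (p : ι) : 0 ≤ D.beta p := by
  have h1 := hD.one_lt_kappa p
  have h2 := (hD.posDefQ p).lamMin_pos hn
  have h3 : 0 < D.kappa p - 1 := by linarith
  unfold beta
  have := eucNorm_nonneg ((D.Bbar p)ᵀ * D.P p * D.Bbar p)
  positivity

theorem IsAdmissible.nu_p_nonneg (hD : D.IsAdmissible) (hn : 1 ≤ n) (p : ι) : 0 ≤ D.nu_p p :=
  le_max_of_le_right (add_nonneg (div_nonneg (hD.beta_nonneg hn p) (hD.rho_pos p).le)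
    (sq_nonneg _))

theorem IsAdmissible.nu_p_lt_one (hD : D.IsAdmissible) (hn : 1 ≤ n) (p : ι) : D.nu_p p < 1 := by
  have h1 := hD.one_lt_kappa p
  have h2 := (hD.posDefQ p).lamMin_pos hn
  have h3 := (hD.posDefP p).lamMax_pos hn
  refine max_lt ?_ ?_
  · have : 0 < D.alpha p / lamMax (D.P p) := by unfold alpha; positivity
    linarith
  · have ht : 0 < 1 - D.theta p ^ 2 := by
      have := hD.theta_lt_one p
      have := theta_nonneg D p
      nlinarith
    have h := hD.lt_rho p
    rw [div_lt_iff₀ ht, mul_comm] at h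
    have h4 : D.beta p / D.rho p < 1 - D.theta p ^ 2 := (div_lt_iff₀ (hD.rho_pos p)).2 h
    linarith

theorem IsAdmissible.nu_nonneg (hD : D.IsAdmissible) (hn : 1 ≤ n) : 0 ≤ D.nu :=
  Real.iSup_nonneg fun p => hD.nu_p_nonneg hn p

theorem IsAdmissible.nu_lt_one [Finite ι] [Nonempty ι] (hD : D.IsAdmissible) (hn : 1 ≤ n) :
    D.nu < 1 := by
  obtain ⟨p, hp⟩ := exists_eq_ciSup_of_finite (f := D.nu_p)
  rw [nu, ← hp]
  exact hD.nu_p_lt_one hn p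

theorem IsAdmissible.V_nonneg (hD : D.IsAdmissible) (p : ι) (x : Fin n → ℝ) (E : ℝ) :
    0 ≤ D.V p x E :=
  add_nonneg (by simpa using (hD.posDefP p).posSemidef.dotProduct_mulVec_nonneg x)
    (mul_nonneg (hD.rho_pos p).le (sq_nonneg _))

/-! ### One step of the Lyapunov function -/

/-- The Lyapunov equation turns the quadratic part into `-xᵀ Q x`, and Young's inequality splits off
the cross term. The share `1/κ` of `lamMin Q` stays as the decrease `alpha`, and the share `1 - 1/κ`
absorbs the cross term, which produces the factor `κ/(κ-1)` in `beta`. The factor `n` there comes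
from passing from the maximum to the Euclidean norm of the error. -/
theorem IsAdmissible.V_noSwitch (hD : D.IsAdmissible) (hn : 1 ≤ n) (p : ι)
    (x e : Fin n → ℝ) {E : ℝ} (he : ‖e‖ ≤ E) :
    D.V p (D.Abar p *ᵥ x - D.Bbar p *ᵥ e) (D.theta p * E) ≤ D.nu_p p * D.V p x E := by
  have hP := (hD.posDefP p).isHermitian
  have hκ := hD.one_lt_kappa p
  have hlam := (hD.posDefQ p).lamMin_pos hn
  have hmax := (hD.posDefP p).lamMax_pos hn
  have hρ := hD.rho_pos p
  have hκ0 : D.kappa p ≠ 0 := by linarith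
  have hκ1 : 0 < D.kappa p - 1 := by linarith
  set c := eucNorm ((D.Abar p)ᵀ * D.P p * D.Bbar p) with hc
  set d := eucNorm ((D.Bbar p)ᵀ * D.P p * D.Bbar p) with hd
  have hc0 : 0 ≤ c := eucNorm_nonneg _
  have hd0 : 0 ≤ d := eucNorm_nonneg _
  have hx0 := vecNorm_nonneg x
  have he0 := vecNorm_nonneg e
  have hL : (D.Abar p)ᵀ * D.P p * D.Abar p = D.P p - D.Q p := by
    have := hD.lyapunov p
    rw [sub_eq_iff_eq_add] at this
    rw [this]; abel
  have h1 : D.V p (D.Abar p *ᵥ x - D.Bbar p *ᵥ e) (D.theta p * E) =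
      x ⬝ᵥ (D.P p *ᵥ x) - x ⬝ᵥ (D.Q p *ᵥ x) -
      2 * (x ⬝ᵥ (((D.Abar p)ᵀ * D.P p * D.Bbar p) *ᵥ e)) +
      e ⬝ᵥ (((D.Bbar p)ᵀ * D.P p * D.Bbar p) *ᵥ e) + D.rho p * (D.theta p * E) ^ 2 := by
    rw [V, quadratic_form_sub (by simpa [Matrix.IsHermitian] using hP), hL, Matrix.sub_mulVec,
      dotProduct_sub]
  have h2 := lamMin_mul_le (hD.posDefQ p).isHermitian x
  have h3 : -(x ⬝ᵥ (((D.Abar p)ᵀ * D.P p * D.Bbar p) *ᵥ e)) ≤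
      vecNorm x * (c * vecNorm e) :=
    ((neg_le_abs _).trans (abs_dotProduct_le _ _)).trans (by
      gcongr
      exact vecNorm_mulVec_le _ _)
  have h4 : e ⬝ᵥ (((D.Bbar p)ᵀ * D.P p * D.Bbar p) *ᵥ e) ≤ d * vecNorm e ^ 2 := by
    refine ((le_abs_self _).trans (abs_dotProduct_le _ _)).trans ?_
    calc _ ≤ vecNorm e * (d * vecNorm e) := by
          gcongr
          exact vecNorm_mulVec_le _ _
      _ = _ := by ring
  -- The weight for Young's inequality: the part of `lamMin Q` not kept in `alpha`.
  set s := (1 - 1 / D.kappa p) * lamMin (D.Q p) with hs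
  have hs0 : 0 < s := by
    have : 1 / D.kappa p < 1 := (div_lt_one (by linarith)).2 hκ
    exact mul_pos (by linarith) hlam
  have h5 := two_mul_le_young (a := vecNorm x) (b := vecNorm e) (c := c) hs0
  have h6 : c ^ 2 / s = D.kappa p / (D.kappa p - 1) * (c ^ 2 / lamMin (D.Q p)) := by
    rw [hs, one_sub_div hκ0, div_mul_eq_mul_div, div_div_eq_mul_div, div_mul_div_comm,
      mul_comm (c ^ 2)]
  have h7 : D.alpha p * vecNorm x ^ 2 = lamMin (D.Q p) * vecNorm x ^ 2 - s * vecNorm x ^ 2 := by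
    rw [hs, alpha]; ring
  clear_value s c d
  have h8 : vecNorm e ^ 2 ≤ n * E ^ 2 :=
    (vecNorm_sq_le e).trans (by gcongr)
  have h9 : (c ^ 2 / s + d) * vecNorm e ^ 2 ≤ D.beta p * E ^ 2 := by
    have : D.beta p = n * (c ^ 2 / s + d) := by rw [h6, beta, hc, hd]
    rw [this]
    have h10 : 0 ≤ c ^ 2 / s + d := by positivity
    exact (mul_le_mul_of_nonneg_left h8 h10).trans_eq (by ring)
  have h10 : D.alpha p / lamMax (D.P p) * (x ⬝ᵥ (D.P p *ᵥ x)) ≤ D.alpha p * vecNorm x ^ 2 := by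
    have ha : 0 ≤ D.alpha p / lamMax (D.P p) := by unfold alpha; positivity
    refine (mul_le_mul_of_nonneg_left (le_lamMax_mul hP x) ha).trans (le_of_eq ?_)
    field_simp
  have hxP : 0 ≤ x ⬝ᵥ (D.P p *ᵥ x) := by
    simpa using (hD.posDefP p).posSemidef.dotProduct_mulVec_nonneg x
  have h11 : (1 - D.alpha p / lamMax (D.P p)) * (x ⬝ᵥ (D.P p *ᵥ x)) ≤
      D.nu_p p * (x ⬝ᵥ (D.P p *ᵥ x)) := mul_le_mul_of_nonneg_right (le_max_left _ _) hxP
  have h12 : (D.beta p / D.rho p + D.theta p ^ 2) * (D.rho p * E ^ 2) ≤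
      D.nu_p p * (D.rho p * E ^ 2) :=
    mul_le_mul_of_nonneg_right (le_max_right _ _) (by positivity)
  have h13 : (D.beta p / D.rho p + D.theta p ^ 2) * (D.rho p * E ^ 2) =
      D.beta p * E ^ 2 + D.rho p * (D.theta p * E) ^ 2 := by
    field_simp
  rw [h1, V]
  linarith

/-- The factor 2 in `nuBar_pq` is that of `(a + b)² ≤ 2(a² + b²)`, which decouples the contributions
of `x` and `E`. -/
theorem IsAdmissible.V_switch (hD : D.IsAdmissible) (hn : 1 ≤ n) (p q : ι) (k : ℕ)
    {x x' : Fin n → ℝ} {E E' : ℝ}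
    (hx' : vecNorm x' ≤ D.alphaBar p q k * vecNorm x + D.betaBar p q k * E)
    (hE' : |E'| ≤ D.deltaBar p q k * vecNorm x + D.gammaBar p q k * E) :
    D.V q x' E' ≤ D.nuBar_pq p q k * D.V p x E := by
  have hmin := (hD.posDefP p).lamMin_pos hn
  have hmax := (hD.posDefP q).lamMax_pos hn
  have hρp := hD.rho_pos p
  have hρq := hD.rho_pos q
  have hsq : ∀ a b : ℝ, (a + b) ^ 2 ≤ 2 * (a ^ 2 + b ^ 2) := fun a b => by
    nlinarith [sq_nonneg (a - b)]
  have h1 : vecNorm x' ^ 2 ≤ 2 * ((D.alphaBar p q k * vecNorm x) ^ 2 +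
      (D.betaBar p q k * E) ^ 2) :=
    (pow_le_pow_left₀ (vecNorm_nonneg _) hx' 2).trans (hsq _ _)
  have h2 : E' ^ 2 ≤ 2 * ((D.deltaBar p q k * vecNorm x) ^ 2 + (D.gammaBar p q k * E) ^ 2) := by
    rw [← sq_abs E']
    exact (pow_le_pow_left₀ (abs_nonneg _) hE' 2).trans (hsq _ _)
  have h3 := le_lamMax_mul (hD.posDefP q).isHermitian x'
  have h4 := lamMin_mul_le (hD.posDefP p).isHermitian x
  have hxP : 0 ≤ x ⬝ᵥ (D.P p *ᵥ x) := (by positivity : 0 ≤ lamMin (D.P p) * _).trans h4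
  set a := 2 * (lamMax (D.P q) * D.alphaBar p q k ^ 2 + D.rho q * D.deltaBar p q k ^ 2) with ha
  set b := 2 * (lamMax (D.P q) * D.betaBar p q k ^ 2 + D.rho q * D.gammaBar p q k ^ 2) with hb
  have ha0 : 0 ≤ a := by positivity
  have h5 : a * vecNorm x ^ 2 ≤ a / lamMin (D.P p) * (x ⬝ᵥ (D.P p *ᵥ x)) := by
    refine le_trans (le_of_eq ?_)
      (mul_le_mul_of_nonneg_left h4 (by positivity : 0 ≤ a / lamMin (D.P p)))
    field_simp
  have h6 : b * E ^ 2 = b / D.rho p * (D.rho p * E ^ 2) := by field_simp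
  have h7 : a / lamMin (D.P p) * (x ⬝ᵥ (D.P p *ᵥ x)) ≤
      D.nuBar_pq p q k * (x ⬝ᵥ (D.P p *ᵥ x)) := mul_le_mul_of_nonneg_right (le_max_left _ _) hxP
  have h8 : b / D.rho p * (D.rho p * E ^ 2) ≤ D.nuBar_pq p q k * (D.rho p * E ^ 2) :=
    mul_le_mul_of_nonneg_right (le_max_right _ _) (by positivity)
  have h9 := mul_le_mul_of_nonneg_left h1 hmax.le
  have h10 := mul_le_mul_of_nonneg_left h2 hρq.le
  calc D.V q x' E' ≤ a * vecNorm x ^ 2 + b * E ^ 2 := by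
        rw [V, ha, hb]
        linarith
    _ ≤ D.nuBar_pq p q k * D.V p x E := by
        rw [V, mul_add, h6]
        linarith

end Design

/-! ### Plant constants and the stacked output map -/

theorem SwitchedSystem.infNorm_A_le_maxA {ι : Type*} [Finite ι] {n m l : ℕ}
    (S : SwitchedSystem ι n m l) (p : ι) : infNorm (S.A p) ≤ S.maxA :=
  le_ciSup (f := fun p => infNorm (S.A p)) (Finite.bddAbove_range _) p

theorem SwitchedSystem.maxA_nonneg {ι : Type*} {n m l : ℕ} (S : SwitchedSystem ι n m l) :
    0 ≤ S.maxA :=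
  Real.iSup_nonneg fun _ => infNorm_nonneg _

theorem SwitchedSystem.W_mulVec {ι : Type*} {n m l : ℕ} (S : SwitchedSystem ι n m l) (τs : ℝ)
    (p : ι) (h : ℕ) (v : Fin n → ℝ) (a : Fin h × Fin l) :
    (S.W τs p h *ᵥ v) a = (S.C p *ᵥ (mexp (S.A p) ((a.1 : ℕ) * τs) *ᵥ v)) a.2 := by
  rw [Matrix.mulVec_mulVec]
  rfl

namespace Design

variable {ι : Type*} {n m l : ℕ} {S : SwitchedSystem ι n m l} {τs : ℝ} {D : Design S τs}
  {σ : ℝ → ι} {x : ℝ → Fin n → ℝ} {u : ℝ → Fin m → ℝ} {ξ : ℝ → Fin n → ℝ}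
  {E : ℕ → ℝ} {q : ℕ → Fin l → ℝ} {k : ℕ} {t₀ : ℝ}

/-! ### The trajectory inside a block -/

theorem IsBlock.hasDeriv (hB : D.IsBlock σ x u ξ E q k) (hx : S.IsSolution σ u x t₀)
    (h0 : t₀ ≤ k * τs) {t : ℝ}
    (ht : t ∈ Ico ((k : ℝ) * τs) ((k + D.blockLen σ k : ℕ) * τs)) :
    HasDerivWithinAt x (S.A (σ t) *ᵥ x t + (S.B (σ t) * D.K (σ (k * τs)) *
      mexp (D.Acl (σ (k * τs))) (t - k * τs)) *ᵥ ξ (k * τs)) (Ici t) t := by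
  have h := hx.2 t (h0.trans ht.1)
  rwa [hB.input t ht, hB.estimate t ht, Matrix.mulVec_mulVec, Matrix.mulVec_mulVec] at h

/-- The forcing `H` vanishes while the mode is still `p`, so the error then evolves by `A_p` alone;
after the switch it is driven by the prediction. The prediction `e^{(A_p + B_p K_p)(s - kτs)}
ξ(kτs)` replaces `ξ` because `ξ` may jump at the end of the block. -/
theorem IsBlock.hasDeriv_error (hB : D.IsBlock σ x u ξ E q k) (hx : S.IsSolution σ u x t₀)
    (h0 : t₀ ≤ k * τs) {t : ℝ}
    (ht : t ∈ Ico ((k : ℝ) * τs) ((k + D.blockLen σ k : ℕ) * τs)) :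
    HasDerivWithinAt (fun s => x s - mexp (D.Acl (σ (k * τs))) (s - k * τs) *ᵥ ξ (k * τs))
      (S.A (σ t) *ᵥ (x t - mexp (D.Acl (σ (k * τs))) (t - k * τs) *ᵥ ξ (k * τs)) +
        (D.H (σ (k * τs)) (σ t) * mexp (D.Acl (σ (k * τs))) (t - k * τs)) *ᵥ ξ (k * τs))
      (Ici t) t := by
  have h := (hB.hasDeriv hx h0 ht).fun_sub
    (hasDerivAt_mexp_mulVec (D.Acl (σ (k * τs))) (ξ (k * τs)) (k * τs) t).hasDerivWithinAt
  refine h.congr_deriv ?_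
  simp only [H, Acl, ← Matrix.mulVec_mulVec, Matrix.mulVec_sub, Matrix.add_mulVec,
    Matrix.sub_mulVec, Matrix.sub_mul]
  abel

theorem continuous_prediction (D : Design S τs) (p : ι) (c : ℝ) (v : Fin n → ℝ) :
    Continuous fun s => mexp (D.Acl p) (s - c) *ᵥ v :=
  Continuous.matrix_mulVec (by fun_prop) continuous_const

theorem IsBlock.error_eq (hB : D.IsBlock σ x u ξ E q k) (hx : S.IsSolution σ u x t₀)
    (h0 : t₀ ≤ k * τs) {T : ℝ} (hT : T ∈ Icc ((k : ℝ) * τs) ((k + D.blockLen σ k : ℕ) * τs))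
    (hσT : ∀ t ∈ Ico ((k : ℝ) * τs) T, σ t = σ (k * τs)) :
    x T - mexp (D.Acl (σ (k * τs))) (T - k * τs) *ᵥ ξ (k * τs) =
      mexp (S.A (σ (k * τs))) (T - k * τs) *ᵥ (x (k * τs) - ξ (k * τs)) := by
  have h := variation_of_constants (A := S.A (σ (k * τs))) (G := fun _ => 0) continuous_const
    (x := fun s => x s - mexp (D.Acl (σ (k * τs))) (s - k * τs) *ᵥ ξ (k * τs)) (v := 0) hT.1
    ((hx.1.mono fun t ht => h0.trans ht.1).sub
      (D.continuous_prediction _ _ _).continuousOn) (fun t ht => by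
      have h := hB.hasDeriv_error hx h0 ⟨ht.1, ht.2.trans_le hT.2⟩
      rw [hσT t ht] at h
      simpa [H] using h)
  simpa using h

theorem IsBlock.state_eq (hB : D.IsBlock σ x u ξ E q k) (hx : S.IsSolution σ u x t₀)
    (h0 : t₀ ≤ k * τs) {T : ℝ} (hT : T ∈ Icc ((k : ℝ) * τs) ((k + D.blockLen σ k : ℕ) * τs))
    (hσT : ∀ t ∈ Ico ((k : ℝ) * τs) T, σ t = σ (k * τs)) :
    x T = mexp (D.Acl (σ (k * τs))) (T - k * τs) *ᵥ x (k * τs) -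
      (mexp (D.Acl (σ (k * τs))) (T - k * τs) - mexp (S.A (σ (k * τs))) (T - k * τs)) *ᵥ
        (x (k * τs) - ξ (k * τs)) := by
  have h := hB.error_eq hx h0 hT hσT
  rw [sub_eq_iff_eq_add] at h
  rw [h, Matrix.sub_mulVec, Matrix.mulVec_sub (mexp (D.Acl _) _)]
  abel

theorem Bbar_eq (D : Design S τs) (p : ι) :
    D.Bbar p = D.Abar p - mexp (S.A p) (S.eta τs p * τs) :=
  mint_mexp_sub _ _ _

/-! ### Blocks without a switch -/

theorem eqOn_samples (hτs : 0 < τs) (hσ : IsSwitchingSignal σ) (hdwell : HasDwellTime σ τs)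
    (D : Design S τs) {i : ℕ} (hi : i < D.blockLen σ k) :
    ∀ t ∈ Icc ((k : ℝ) * τs) ((k + i : ℕ) * τs), σ t = σ (k * τs) :=
  hσ.eqOn_of_samples hτs hdwell k i fun j hj =>
    D.mode_of_lt_blockLen σ k j (hj.trans_lt hi)

theorem sample_mem (hτs : 0 < τs) (D : Design S τs) {i : ℕ} (hi : i ≤ D.blockLen σ k) :
    ((k + i : ℕ) : ℝ) * τs ∈ Icc ((k : ℝ) * τs) ((k + D.blockLen σ k : ℕ) * τs) :=
  ⟨by gcongr; omega, by gcongr⟩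

/-- The differences `y - C_p ξ` at the samples of the block stack to `W_p e`, from which the left
inverse recovers `e` exactly. Using quantized outputs instead, the new error is `e^{A_p η_p τs}
Wd_p` applied to the quantization errors, each at most the box radius divided by `N`; this is
`theta_p E`. -/
theorem IsBlock.error_noSwitch (hB : D.IsBlock σ x u ξ E q k) (hD : D.IsAdmissible)
    (hx : S.IsSolution σ u x t₀) (h0 : t₀ ≤ k * τs) (hτs : 0 < τs) (hσ : IsSwitchingSignal σ)
    (hdwell : HasDwellTime σ τs) (hE : ‖x (k * τs) - ξ (k * τs)‖ ≤ E k)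
    (hno : σ ((k + D.blockLen σ k : ℕ) * τs) = σ (k * τs)) :
    ‖x ((k + D.blockLen σ k : ℕ) * τs) - ξ ((k + D.blockLen σ k : ℕ) * τs)‖ ≤
      E (k + D.blockLen σ k) := by
  have hE0 : 0 ≤ E k := (norm_nonneg _).trans hE
  have hL := D.blockLen_eq_eta σ k hno
  set p := σ (k * τs) with hp
  set e := x (k * τs) - ξ (k * τs) with he
  have hconst := hσ.eqOn_of_samples hτs hdwell k (D.blockLen σ k) fun i hi => by
    rcases hi.eq_or_lt with rfl | hi
    · exact hno
    · exact D.mode_of_lt_blockLen σ k i hi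
  have herr : ∀ i ≤ D.blockLen σ k, x ((k + i : ℕ) * τs) -
      mexp (D.Acl p) (i * τs) *ᵥ ξ (k * τs) = mexp (S.A p) (i * τs) *ᵥ e := by
    intro i hi
    have hm := sample_mem hτs D hi
    have h := hB.error_eq hx h0 hm fun t ht => hconst t ⟨ht.1, ht.2.le.trans hm.2⟩
    rwa [show ((k + i : ℕ) : ℝ) * τs - k * τs = i * τs by push_cast; ring] at h
  set y : Fin (S.eta τs p) × Fin l → ℝ := fun a =>
    (S.C p *ᵥ x ((k + a.1 : ℕ) * τs)) a.2 with hy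
  set z : Fin (S.eta τs p) × Fin l → ℝ := fun a =>
    q (k + a.1) a.2 - (S.C p *ᵥ ξ ((k + a.1 : ℕ) * τs)) a.2 with hz
  have hξ : ∀ i < D.blockLen σ k, ξ ((k + i : ℕ) * τs) =
      mexp (D.Acl p) (i * τs) *ᵥ ξ (k * τs) := by
    intro i hi
    have h := hB.estimate ((k + i : ℕ) * τs) ⟨(sample_mem hτs D hi.le).1, by gcongr⟩
    rwa [show ((k + i : ℕ) : ℝ) * τs - k * τs = i * τs by push_cast; ring] at h
  have hWe : e = D.Wd p *ᵥ (fun a : Fin (S.eta τs p) × Fin l =>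
      y a - (S.C p *ᵥ ξ ((k + a.1 : ℕ) * τs)) a.2) := by
    have h1 : (fun a : Fin (S.eta τs p) × Fin l =>
      y a - (S.C p *ᵥ ξ ((k + a.1 : ℕ) * τs)) a.2) = S.W τs p (S.eta τs p) *ᵥ e := by
      funext a
      have ha : (a.1 : ℕ) < D.blockLen σ k := a.1.2.trans_eq hL.symm
      rw [S.W_mulVec, ← herr a.1 ha.le, Matrix.mulVec_sub, hξ a.1 ha]
      rfl
    rw [h1, Matrix.mulVec_mulVec, hD.leftInverse, Matrix.one_mulVec]
  have hnew : x ((k + D.blockLen σ k : ℕ) * τs) - ξ ((k + D.blockLen σ k : ℕ) * τs) =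
      (mexp (S.A p) (S.eta τs p * τs) * D.Wd p) *ᵥ
        fun a : Fin (S.eta τs p) × Fin l => y a - q (k + a.1) a.2 := by
    have h1 := herr _ le_rfl
    rw [sub_eq_iff_eq_add] at h1
    have h2 : (fun a : Fin (S.eta τs p) × Fin l => y a - q (k + a.1) a.2) =
        (fun a : Fin (S.eta τs p) × Fin l =>
          y a - (S.C p *ᵥ ξ ((k + a.1 : ℕ) * τs)) a.2) - z := by
      funext a
      simp [hz]
    rw [h2, Matrix.mulVec_sub, ← Matrix.mulVec_mulVec, ← hWe, hB.estimate_noSwitch hno, h1, hL]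
    abel
  rw [hnew, hB.bound_noSwitch hno]
  refine (norm_mulVec_le_infNorm _ _).trans ?_
  rw [theta, rate, mul_div_assoc, mul_assoc]
  refine mul_le_mul_of_nonneg_left ?_ (infNorm_nonneg _)
  have hsup : 0 ≤ ⨆ i : Fin (S.eta τs p), infNorm (S.C p * mexp (S.A p) ((i : ℕ) * τs)) :=
    Real.iSup_nonneg fun _ => infNorm_nonneg _
  rw [pi_norm_le_iff_of_nonneg (by positivity)]
  intro a
  have ha : (a.1 : ℕ) < D.blockLen σ k := a.1.2.trans_eq hL.symm
  obtain ⟨_, hq⟩ := hB.quantize a.1 ha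
  have h2 := (hq a.2).2
  rw [D.mode_of_lt_blockLen σ k a.1 ha] at h2
  refine h2.trans ?_
  rw [div_mul_eq_mul_div]
  have hN := hD.N_pos
  gcongr
  exact le_ciSup (f := fun i : Fin (S.eta τs p) =>
    infNorm (S.C p * mexp (S.A p) ((i : ℕ) * τs))) (Finite.bddAbove_range _) a.1

theorem IsBlock.V_noSwitch (hB : D.IsBlock σ x u ξ E q k) (hD : D.IsAdmissible) (hn : 1 ≤ n)
    (hx : S.IsSolution σ u x t₀) (h0 : t₀ ≤ k * τs) (hτs : 0 < τs) (hσ : IsSwitchingSignal σ)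
    (hdwell : HasDwellTime σ τs) (hE : ‖x (k * τs) - ξ (k * τs)‖ ≤ E k)
    (hno : σ ((k + D.blockLen σ k : ℕ) * τs) = σ (k * τs)) :
    D.V (σ ((k + D.blockLen σ k : ℕ) * τs)) (x ((k + D.blockLen σ k : ℕ) * τs))
      (E (k + D.blockLen σ k)) ≤ D.nu_p (σ (k * τs)) * D.V (σ (k * τs)) (x (k * τs)) (E k) := by
  have hconst := hσ.eqOn_of_samples hτs hdwell k (D.blockLen σ k) fun i hi => by
    rcases hi.eq_or_lt with rfl | hi
    · exact hno
    · exact D.mode_of_lt_blockLen σ k i hi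
  have h := hB.state_eq hx h0 (sample_mem hτs D le_rfl)
    fun t ht => hconst t ⟨ht.1, ht.2.le⟩
  rw [show ((k + D.blockLen σ k : ℕ) : ℝ) * τs - k * τs = D.blockLen σ k * τs by
    push_cast; ring] at h
  rw [h, hB.bound_noSwitch hno, hno, D.blockLen_eq_eta σ k hno]
  have h2 := hD.V_noSwitch hn (σ (k * τs)) (x (k * τs)) _ hE
  rwa [Bbar_eq] at h2

/-! ### Blocks that end with a switch -/

/-- All samples before the last interval have mode `p`, and that interval contains one switch, at
offset `τ` from its start. The error and the state are propagated by mode `p` up to the switch and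
by the new mode afterwards; the resulting matrices are those inside `deltaBar`, `gammaBar'`,
`alphaBar` and `betaBar` at this `τ`. -/
theorem IsBlock.switch (hB : D.IsBlock σ x u ξ E q k) (hD : D.IsAdmissible) (hn : 1 ≤ n)
    (hx : S.IsSolution σ u x t₀) (h0 : t₀ ≤ k * τs) (hτs : 0 < τs) (hσ : IsSwitchingSignal σ)
    (hdwell : HasDwellTime σ τs) (hE : ‖x (k * τs) - ξ (k * τs)‖ ≤ E k)
    (hsw : σ ((k + D.blockLen σ k : ℕ) * τs) ≠ σ (k * τs)) :
    ‖x ((k + D.blockLen σ k : ℕ) * τs) - ξ ((k + D.blockLen σ k : ℕ) * τs)‖ ≤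
        E (k + D.blockLen σ k) ∧
      D.V (σ ((k + D.blockLen σ k : ℕ) * τs)) (x ((k + D.blockLen σ k : ℕ) * τs))
        (E (k + D.blockLen σ k)) ≤
        D.nuBar_pq (σ (k * τs)) (σ ((k + D.blockLen σ k : ℕ) * τs)) (D.blockLen σ k) *
          D.V (σ (k * τs)) (x (k * τs)) (E k) := by
  have hE0 : 0 ≤ E k := (norm_nonneg _).trans hE
  have hL1 := hD.one_le_blockLen hn σ k
  have hξnew := hB.estimate_switch hsw
  have hEnew := hB.bound_switch hsw
  have hderE := fun t => hB.hasDeriv_error (t := t) hx h0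
  have hder := fun t => hB.hasDeriv (t := t) hx h0
  have herrT := fun T => hB.error_eq (T := T) hx h0
  have hstT := fun T => hB.state_eq (T := T) hx h0
  have hlast := D.mode_of_lt_blockLen σ k (D.blockLen σ k - 1) (by omega)
  have hbefore := eqOn_samples hτs hσ hdwell D (k := k) (i := D.blockLen σ k - 1) (by omega)
  set L := D.blockLen σ k with hLdef
  set p := σ (k * τs) with hp
  set r := σ ((k + L : ℕ) * τs) with hr
  set e := x (k * τs) - ξ (k * τs) with he
  -- `a` is the last sample before the detected mode change.
  obtain ⟨a, ha⟩ : ∃ a : ℝ, a = k * τs + ((L : ℝ) - 1) * τs := ⟨_, rfl⟩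
  have haL : ((k + (L - 1) : ℕ) : ℝ) * τs = a := by rw [ha]; push_cast [Nat.cast_sub hL1]; ring
  have hbL : ((k + L : ℕ) : ℝ) * τs = τs + a := by rw [ha]; push_cast; ring
  have hka : (k : ℝ) * τs ≤ a := by
    rw [← haL]
    gcongr
    omega
  have hk0 : 0 ≤ (k : ℝ) * τs := by positivity
  rw [haL] at hlast hbefore
  rw [hbL] at hr hξnew hderE hder herrT hstT ⊢
  obtain ⟨T, hT, hTl, hTr⟩ := hσ.exists_switch (a := a) (b := τs + a) (hk0.trans hka)
    (by linarith) (hdwell _ _ (hk0.trans hka) (by linarith) (by linarith))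
  obtain ⟨τ, rfl⟩ : ∃ τ, T = τ + a := ⟨T - a, by ring⟩
  have hτ : τ ∈ Icc 0 τs := ⟨by linarith [hT.1], by linarith [hT.2]⟩
  have hTk : (k : ℝ) * τs ≤ τ + a := by linarith [hτ.1]
  have hTb : τ + a ≤ τs + a := by linarith [hτ.2]
  have hpre : ∀ t ∈ Ico ((k : ℝ) * τs) (τ + a), σ t = p := by
    intro t ht
    rcases le_total t a with h | h
    · exact hbefore t ⟨ht.1, h⟩
    · rw [hTl t ⟨h, ht.2⟩, hlast]
  have hpost : ∀ t ∈ Ico (τ + a) (τs + a), σ t = r := fun t ht => by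
    rw [hTr t ⟨ht.1, ht.2.le⟩, hr]
  have hτk : τ + a - k * τs = ((L : ℝ) - 1) * τs + τ := by rw [ha]; ring
  have herr := herrT _ ⟨hTk, hTb⟩ hpre
  have hst := hstT _ ⟨hTk, hTb⟩ hpre
  rw [hτk] at herr hst
  have hξc := (D.continuous_prediction p (k * τs) (ξ (k * τs))).continuousOn
    (s := Icc (τ + a) (τs + a))
  have hxc : ContinuousOn x (Icc (τ + a) (τs + a)) :=
    hx.1.mono fun t ht => (h0.trans hTk).trans ht.1
  have hve := variation_of_constants (A := S.A r)
    (G := fun t => D.H p r * mexp (D.Acl p) (t - k * τs)) (by fun_prop)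
    (v := ξ (k * τs)) hTb (hxc.sub hξc) (fun t ht => by
      have h := hderE t ⟨hTk.trans ht.1, ht.2⟩
      rwa [hpost t ht] at h)
  have hvx := variation_of_constants (A := S.A r)
    (G := fun t => S.B r * D.K p * mexp (D.Acl p) (t - k * τs)) (by fun_prop)
    (v := ξ (k * τs)) hTb hxc (fun t ht => by
      have h := hder t ⟨hTk.trans ht.1, ht.2⟩
      rwa [hpost t ht] at h)
  -- Time is shifted by `a`, so that the integrals run from `τ` to `τs` as in the design constants.
  have hshift : ∀ M : Matrix (Fin n) (Fin n) ℝ,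
      mint (fun t => mexp (S.A r) (τs + a - t) * (M * mexp (D.Acl p) (t - k * τs)))
        (τ + a) (τs + a) =
      mint (fun t => mexp (S.A r) (τs - t) * M * mexp (D.Acl p) (t + ((L : ℝ) - 1) * τs)) τ τs := by
    intro M
    rw [mint_comp_add]
    congr 1
    funext t
    rw [Matrix.mul_assoc, show τs + a - (t + a) = τs - t by ring,
      show t + a - k * τs = t + ((L : ℝ) - 1) * τs by rw [ha]; ring]
  rw [hshift, show τs + a - (τ + a) = τs - τ by ring] at hve hvx
  have hb : τs + a - k * τs = L * τs := by rw [ha]; ring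
  rw [Pi.sub_apply, Pi.sub_apply, hτk, herr, Matrix.mulVec_mulVec, hb, ← hξnew] at hve
  rw [hst] at hvx
  have hδ := D.infNorm_le_deltaBar p r L hτ
  have hγ := D.infNorm_le_gammaBar' p r L hτ
  have hδ0 := (infNorm_nonneg _).trans hδ
  have hγ0 := (infNorm_nonneg _).trans hγ
  have hnew : ‖x (τs + a) - ξ (τs + a)‖ ≤ E (k + L) := by
    rw [hve, hEnew, add_comm]
    refine (norm_add_le _ _).trans (add_le_add ?_ ?_)
    · exact (norm_mulVec_le_infNorm _ _).trans (by gcongr)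
    · exact (norm_mulVec_le_infNorm _ _).trans (by gcongr)
  refine ⟨hnew, hD.V_switch hn p r L ?_ ?_⟩
  · have hα := D.eucNorm_le_alphaBar p r L hτ
    have hβ := D.eucNorm_le_betaBar p r L hτ
    -- Substituting `ξ = x - e` in the input after the switch gives the mismatch integral acting on
    -- both `x` and `e`, with the same sign as the earlier terms.
    have hx' : x (τs + a) = (mexp (S.A r) (τs - τ) * mexp (D.Acl p) (((L : ℝ) - 1) * τs + τ) +
        D.mismatch p r L τ) *ᵥ x (k * τs) - (mexp (S.A r) (τs - τ) *
        (mexp (D.Acl p) (((L : ℝ) - 1) * τs + τ) - mexp (S.A p) (((L : ℝ) - 1) * τs + τ)) +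
        D.mismatch p r L τ) *ᵥ e := by
      have hξe : ξ (k * τs) = x (k * τs) - e := by rw [he]; abel
      rw [hvx, hξe, mismatch]
      simp only [Matrix.mulVec_sub, Matrix.add_mulVec, ← Matrix.mulVec_mulVec]
      abel
    rw [hx']
    refine (vecNorm_sub_le _ _).trans (add_le_add ?_ ?_)
    · refine (vecNorm_mulVec_le _ _).trans ?_
      exact mul_le_mul_of_nonneg_right hα (vecNorm_nonneg _)
    · refine (vecNorm_mulVec_le _ _).trans ?_
      calc _ ≤ eucNorm _ * (√n * E k) := by
            refine mul_le_mul_of_nonneg_left ((vecNorm_le e).trans ?_) (eucNorm_nonneg _)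
            gcongr
        _ ≤ _ := by
            rw [← mul_assoc, mul_comm (eucNorm _)]
            exact mul_le_mul_of_nonneg_right hβ hE0
  · rw [abs_of_nonneg ((norm_nonneg _).trans hnew), hEnew, gammaBar, add_mul, ← add_assoc,
      ← mul_add]
    -- Bounding the estimate by state plus error is what turns `gammaBar'` into `gammaBar = deltaBar
    -- + gammaBar'`.
    have h1 : ‖ξ (k * τs)‖ ≤ vecNorm (x (k * τs)) + E k := by
      have h2 : ξ (k * τs) = x (k * τs) - e := by rw [he]; abel
      rw [h2]
      exact (norm_sub_le _ _).trans (add_le_add (norm_le_vecNorm _) hE)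
    gcongr

end Design

/-! ### Convergence criteria and Grönwall bounds -/

theorem tendsto_zero_of_frequent_bound {α X : Type*} [SeminormedAddCommGroup X] {l : Filter α}
    {f : α → X} {h : ℕ → ℝ} (hh : Tendsto h atTop (𝓝 0))
    (hf : ∀ j, ∀ᶠ t in l, ∃ i ≥ j, ‖f t‖ ≤ h i) : Tendsto f l (𝓝 0) := by
  rw [NormedAddGroup.tendsto_nhds_zero]
  intro ε hε
  obtain ⟨J, hJ⟩ := eventually_atTop.1 (hh.eventually (gt_mem_nhds hε))
  filter_upwards [hf J] with t ht
  obtain ⟨i, hi, hle⟩ := ht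
  exact hle.trans_lt (hJ i hi)

theorem StrictMono.exists_mem_Ico {r : ℕ → ℕ} (hr : StrictMono r) {τs : ℝ} (hτs : 0 < τs)
    {J : ℕ} {t : ℝ} (ht : r J * τs ≤ t) :
    ∃ j ≥ J, t ∈ Ico ((r j : ℝ) * τs) (r (j + 1) * τs) := by
  have hex : ∃ i, t < r (J + i) * τs := by
    obtain ⟨i, hi⟩ := exists_nat_gt (t / τs)
    refine ⟨i, (div_lt_iff₀ hτs).1 (hi.trans_le ?_)⟩
    exact_mod_cast (hr.le_apply (x := J + i)).trans' (Nat.le_add_left i J)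
  have h1 := Nat.find_spec hex
  have h2 := fun {i} => Nat.find_min hex (m := i)
  rcases hN : Nat.find hex with _ | N
  · rw [hN] at h1
    exact absurd h1 (not_lt.2 ht)
  · rw [hN] at h1 h2
    exact ⟨J + N, by omega, not_lt.1 (h2 N.lt_succ_self), h1⟩

/-- Grönwall's inequality for right derivatives. -/
theorem norm_le_of_norm_deriv_right_le {X : Type*} [NormedAddCommGroup X] [NormedSpace ℝ X]
    {f f' : ℝ → X} {K ε a b : ℝ} (hK : 0 < K) (hε : 0 ≤ ε) (hf : ContinuousOn f (Icc a b))
    (hf' : ∀ t ∈ Ico a b, HasDerivWithinAt f (f' t) (Ici t) t)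
    (hbd : ∀ t ∈ Ico a b, ‖f' t‖ ≤ K * ‖f t‖ + ε) {t : ℝ} (ht : t ∈ Icc a b) :
    ‖f t‖ ≤ (‖f a‖ + ε / K) * Real.exp (K * (t - a)) := by
  have h := norm_le_gronwallBound_of_norm_deriv_right_le hf hf' le_rfl hbd t ht
  rw [gronwallBound_of_K_ne_0 hK.ne'] at h
  refine h.trans ?_
  have : 0 ≤ ε / K := by positivity
  beta_reduce
  linarith

theorem tendsto_zero_of_two_rates {v : ℕ → ℝ} (hv : ∀ j, 0 ≤ v j) {s : ℕ → ℕ} {a b c N₀ : ℝ}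
    (hab : 0 ≤ a + b) (hc : (a + b) * c < b)
    (h0 : ∀ j, s j = 0 → v (j + 1) ≤ Real.exp (-b) * v j)
    (h1 : ∀ j, s j ≠ 0 → s j = 1 ∧ v (j + 1) ≤ Real.exp a * v j)
    (hs : ∀ J : ℕ, ((∑ j ∈ Finset.range J, s j : ℕ) : ℝ) ≤ N₀ + J * c) :
    Tendsto v atTop (𝓝 0) := by
  have hbound : ∀ J : ℕ, v J ≤ Real.exp ((a + b) * ((∑ j ∈ Finset.range J, s j : ℕ) : ℝ) -
      b * J) * v 0 := by
    intro J
    induction J with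
    | zero => simp
    | succ J ih =>
      rw [Finset.sum_range_succ]
      by_cases hJ : s J = 0
      · refine (h0 J hJ).trans ((mul_le_mul_of_nonneg_left ih (Real.exp_pos _).le).trans_eq ?_)
        rw [← mul_assoc, ← Real.exp_add, hJ]
        push_cast
        ring_nf
      · obtain ⟨hs1, hJ'⟩ := h1 J hJ
        refine hJ'.trans ((mul_le_mul_of_nonneg_left ih (Real.exp_pos _).le).trans_eq ?_)
        rw [← mul_assoc, ← Real.exp_add, hs1]
        push_cast
        ring_nf
  have hbound2 : ∀ J : ℕ, v J ≤ Real.exp ((a + b) * N₀ + J * ((a + b) * c - b)) * v 0 := by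
    intro J
    refine (hbound J).trans (mul_le_mul_of_nonneg_right (Real.exp_le_exp.2 ?_) (hv 0))
    -- Each marked step replaces a decay by `b` with a growth by `a`, a loss of `a + b`; its
    -- nonnegativity lets the count be replaced by its upper bound.
    have := mul_le_mul_of_nonneg_left (hs J) hab
    linarith
  refine squeeze_zero hv hbound2 ?_
  rw [← zero_mul (v 0)]
  refine (Real.tendsto_exp_atBot.comp (tendsto_atBot_add_const_left _ _ ?_)).mul_const _
  exact tendsto_natCast_atTop_atTop.atTop_mul_const_of_neg (by linarith)

/-- A decay exponent compatible with the average dwell time. -/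
theorem exists_decay_exponent {a ν X τa : ℝ} (ha : 0 ≤ a) (hν : 0 ≤ ν) (hν1 : ν < 1)
    (hX : 0 ≤ X) (h : (1 + a / Real.log (1 / ν)) * X < τa) :
    ∃ b, 0 < b ∧ ν ≤ Real.exp (-b) ∧ (a + b) * X < b * τa := by
  rcases hν.eq_or_lt with rfl | hν
  · simp only [div_zero, Real.log_zero, add_zero, one_mul] at h
    -- For `ν = 0` the quotient by `log (1/ν) = 0` is `0` by convention, so the hypothesis is just
    -- `X < τa`. Any decay rate is then available, and one above `a X / (τa - X)` is chosen.
    have h' : 0 < τa - X := by linarith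
    refine ⟨a * X / (τa - X) + 1, by positivity, (Real.exp_pos _).le, ?_⟩
    have : a * X / (τa - X) * (τa - X) = a * X := div_mul_cancel₀ _ h'.ne'
    linarith
  · have hb : 0 < Real.log (1 / ν) := Real.log_pos ((one_lt_div hν).2 hν1)
    refine ⟨Real.log (1 / ν), hb, ?_, ?_⟩
    · rw [one_div, Real.log_inv, neg_neg, Real.exp_log hν]
    · have h2 := mul_lt_mul_of_pos_left h hb
      refine lt_of_eq_of_lt ?_ h2
      field_simp
      ring

theorem SwitchedSystem.eta_le_etaMax {ι : Type*} [Fintype ι] {n m l : ℕ}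
    (S : SwitchedSystem ι n m l) (τs : ℝ) (p : ι) : S.eta τs p ≤ S.etaMax τs :=
  Finset.le_sup (f := S.eta τs) (Finset.mem_univ p)

/-- Growth of the plant state under the input `0`. -/
theorem SwitchedSystem.IsSolution.norm_le_of_input_zero {ι : Type*} [Finite ι] {n m l : ℕ}
    {S : SwitchedSystem ι n m l} {σ : ℝ → ι} {u : ℝ → Fin m → ℝ} {x : ℝ → Fin n → ℝ} {t₀ a b : ℝ}
    (hx : S.IsSolution σ u x t₀) (ha : t₀ ≤ a) (hab : a ≤ b) (hu : ∀ t ∈ Ico a b, u t = 0) :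
    ‖x b‖ ≤ Real.exp (S.maxA * (b - a)) * ‖x a‖ := by
  have h := norm_le_gronwallBound_of_norm_deriv_right_le (K := S.maxA) (ε := 0)
    (f' := fun t => S.A (σ t) *ᵥ x t)
    (hx.1.mono fun t (ht : t ∈ Icc a b) => ha.trans ht.1)
    (fun t ht => by simpa [hu t ht] using hx.2 t (ha.trans ht.1)) le_rfl
    (fun t _ => by
      rw [add_zero]
      exact (norm_mulVec_le_infNorm _ _).trans
        (mul_le_mul_of_nonneg_right (S.infNorm_A_le_maxA _) (norm_nonneg _))) b ⟨hab, le_rfl⟩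
  rwa [gronwallBound_ε0, mul_comm] at h

namespace Design

variable {ι : Type*} {n m l : ℕ} {S : SwitchedSystem ι n m l} {τs : ℝ} {D : Design S τs}
  {σ : ℝ → ι} {x : ℝ → Fin n → ℝ} {u : ℝ → Fin m → ℝ} {ξ : ℝ → Fin n → ℝ}
  {E : ℕ → ℝ} {q : ℕ → Fin l → ℝ} {k : ℕ} {t₀ : ℝ}

/-! ### The zooming-in stage -/

/-- The constant depends only on the design: blocks last at most `η τs`, and the input matrix is
bounded over all pairs of the mode fixing the gain and the mode actually active. -/
theorem exists_block_bound [Fintype ι] (D : Design S τs) (hτs : 0 < τs) :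
    ∃ c, 0 ≤ c ∧ ∀ (σ : ℝ → ι) (x : ℝ → Fin n → ℝ) (u : ℝ → Fin m → ℝ) (ξ : ℝ → Fin n → ℝ)
      (E : ℕ → ℝ) (q : ℕ → Fin l → ℝ) (k : ℕ) (t₀ : ℝ), D.IsBlock σ x u ξ E q k →
      S.IsSolution σ u x t₀ → t₀ ≤ k * τs →
      ∀ t ∈ Icc ((k : ℝ) * τs) ((k + D.blockLen σ k : ℕ) * τs),
        ‖x t‖ ≤ c * (‖x (k * τs)‖ + ‖ξ (k * τs)‖) := by
  set T := S.etaMax τs * τs with hTdef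
  have hT : 0 ≤ T := by positivity
  set g : ι × ι → ℝ := fun z =>
    ⨆ s : Icc 0 T, infNorm (S.B z.2 * D.K z.1 * mexp (D.Acl z.1) s) with hg
  set b := ⨆ z, g z with hbdef
  have hb0 : 0 ≤ b := Real.iSup_nonneg fun z => Real.iSup_nonneg fun s => infNorm_nonneg _
  have hb : ∀ p r, ∀ s ∈ Icc 0 T, infNorm (S.B r * D.K p * mexp (D.Acl p) s) ≤ b := by
    intro p r s hs
    refine le_trans ?_ (le_ciSup (f := g) (Finite.bddAbove_range _) (p, r))
    exact le_iSup_Icc (f := fun s => infNorm (S.B r * D.K p * mexp (D.Acl p) s))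
      (continuous_infNorm.comp (by fun_prop)) hs
  -- One is added because `maxA` may be `0` and the Grönwall bound divides by the rate.
  have hK : 0 < S.maxA + 1 := by linarith [S.maxA_nonneg]
  refine ⟨(1 + b / (S.maxA + 1)) * Real.exp ((S.maxA + 1) * T), by positivity, ?_⟩
  intro σ x u ξ E q k t₀ hB hx h0 t ht
  have hlen : ∀ t ∈ Icc ((k : ℝ) * τs) ((k + D.blockLen σ k : ℕ) * τs), t - k * τs ∈ Icc 0 T := by
    intro t ht
    refine ⟨by linarith [ht.1], ?_⟩
    have h1 : (D.blockLen σ k : ℝ) ≤ S.etaMax τs := by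
      exact_mod_cast (D.blockLen_le σ k).trans (S.eta_le_etaMax τs _)
    have h2 := ht.2
    push_cast at h2
    have := mul_le_mul_of_nonneg_right h1 hτs.le
    linarith
  have h := norm_le_of_norm_deriv_right_le hK (ε := b * ‖ξ (k * τs)‖) (by positivity)
    (hx.1.mono fun t (ht : t ∈ Icc _ _) => h0.trans ht.1) (fun t ht => hB.hasDeriv hx h0 ht)
    (fun t ht => by
      refine (norm_add_le _ _).trans (add_le_add ?_ ?_)
      · refine (norm_mulVec_le_infNorm _ _).trans
          (mul_le_mul_of_nonneg_right ?_ (norm_nonneg _))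
        linarith [S.infNorm_A_le_maxA (σ t)]
      · exact (norm_mulVec_le_infNorm _ _).trans
          (mul_le_mul_of_nonneg_right (hb _ _ _ (hlen t ⟨ht.1, ht.2.le⟩)) (norm_nonneg _))) ht
  refine h.trans ?_
  rw [mul_right_comm]
  have h3 : ‖x (k * τs)‖ + b * ‖ξ (k * τs)‖ / (S.maxA + 1) ≤
      (1 + b / (S.maxA + 1)) * (‖x (k * τs)‖ + ‖ξ (k * τs)‖) := by
    have : 0 ≤ b / (S.maxA + 1) * ‖x (k * τs)‖ := by positivity
    rw [mul_div_right_comm]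
    linarith [norm_nonneg (ξ (k * τs))]
  have h4 : (S.maxA + 1) * (t - k * τs) ≤ (S.maxA + 1) * T :=
    mul_le_mul_of_nonneg_left (hlen t ht).2 hK.le
  exact mul_le_mul h3 (Real.exp_le_exp.2 h4) (Real.exp_pos _).le (by positivity)

theorem IsAdmissible.exists_V_lower [Finite ι] [Nonempty ι] (hD : D.IsAdmissible) (hn : 1 ≤ n) :
    ∃ c, 0 < c ∧ ∀ p (x : Fin n → ℝ) (E : ℝ), c * (‖x‖ ^ 2 + E ^ 2) ≤ D.V p x E := by
  obtain ⟨p₀, hp₀⟩ := Finite.exists_min fun p => min (lamMin (D.P p)) (D.rho p)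
  refine ⟨min (lamMin (D.P p₀)) (D.rho p₀),
    lt_min ((hD.posDefP p₀).lamMin_pos hn) (hD.rho_pos p₀), fun p x E => ?_⟩
  have h1 := (hp₀ p).trans (min_le_left _ _)
  have h2 := (hp₀ p).trans (min_le_right _ _)
  have h3 := lamMin_mul_le (hD.posDefP p).isHermitian x
  have h4 : ‖x‖ ^ 2 ≤ vecNorm x ^ 2 := pow_le_pow_left₀ (norm_nonneg _) (norm_le_vecNorm x) 2
  rw [mul_add, V]
  refine add_le_add (le_trans ?_ h3) (mul_le_mul_of_nonneg_right h2 (sq_nonneg _))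
  exact mul_le_mul h1 h4 (sq_nonneg _) ((hD.posDefP p).lamMin_pos hn).le

theorem IsAdmissible.exists_V_upper [Finite ι] [Nonempty ι] (hD : D.IsAdmissible) (hn : 1 ≤ n) :
    ∃ c, 0 < c ∧ ∀ p (x : Fin n → ℝ) (E : ℝ), D.V p x E ≤ c * (‖x‖ ^ 2 + E ^ 2) := by
  obtain ⟨p₀, hp₀⟩ := Finite.exists_max fun p => max (lamMax (D.P p) * n) (D.rho p)
  refine ⟨max (lamMax (D.P p₀) * n) (D.rho p₀), lt_max_of_lt_right (hD.rho_pos p₀),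
    fun p x E => ?_⟩
  have h1 := (le_max_left _ _).trans (hp₀ p)
  have h2 := (le_max_right _ _).trans (hp₀ p)
  have h3 := le_lamMax_mul (hD.posDefP p).isHermitian x
  have h4 := mul_le_mul_of_nonneg_left (vecNorm_sq_le x) ((hD.posDefP p).lamMax_pos hn).le
  rw [mul_add, V]
  refine add_le_add ((h3.trans h4).trans ?_) (mul_le_mul_of_nonneg_right h2 (sq_nonneg _))
  rw [← mul_assoc]
  exact mul_le_mul_of_nonneg_right h1 (sq_nonneg _)

theorem IsAdmissible.strictMono_updateTime (hD : D.IsAdmissible) (hn : 1 ≤ n) (σ : ℝ → ι)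
    (k₀ : ℕ) : StrictMono (D.updateTime σ k₀) :=
  strictMono_nat_of_lt_succ fun j => by
    rw [updateTime]
    exact Nat.lt_add_of_pos_right (hD.one_le_blockLen hn σ _)

theorem IsAdmissible.sample_le_updateTime (hD : D.IsAdmissible) (hn : 1 ≤ n) (hτs : 0 < τs)
    (σ : ℝ → ι) (k j : ℕ) : (k : ℝ) * τs ≤ D.updateTime σ k j * τs := by
  have := (hD.strictMono_updateTime hn σ k).monotone (Nat.zero_le j)
  gcongr
  exact this

theorem IsZoomIn.error_le (hz : D.IsZoomIn σ x u ξ E q k) (hD : D.IsAdmissible) (hn : 1 ≤ n)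
    (hτs : 0 < τs) (hσ : IsSwitchingSignal σ) (hdwell : HasDwellTime σ τs) (j : ℕ) :
    ‖x (D.updateTime σ k j * τs) - ξ (D.updateTime σ k j * τs)‖ ≤ E (D.updateTime σ k j) := by
  induction j with
  | zero => exact hz.start
  | succ j ih =>
    have h0 := hD.sample_le_updateTime hn hτs σ k j
    by_cases h : σ ((D.updateTime σ k j + D.blockLen σ (D.updateTime σ k j) : ℕ) * τs) =
        σ (D.updateTime σ k j * τs)
    · exact (hz.blocks j).error_noSwitch hD hz.plant h0 hτs hσ hdwell ih h
    · exact ((hz.blocks j).switch hD hn hz.plant h0 hτs hσ hdwell ih h).1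

theorem IsZoomIn.tendsto_V_updateTime [Fintype ι] (hz : D.IsZoomIn σ x u ξ E q k)
    (hD : D.IsAdmissible) (hn : 1 ≤ n)
    (hτs : 0 < τs) (hσ : IsSwitchingSignal σ) (hdwell : HasDwellTime σ τs)
    {τa : ℝ} (hτa : 0 < τa) {N0 : ℕ} (hadt : HasAverageDwellTime σ τa N0)
    (hcond : (1 + Real.log D.nuBar / Real.log (1 / D.nu)) * (S.etaMax τs * τs) < τa) :
    Tendsto (fun j => D.V (σ (D.updateTime σ k j * τs)) (x (D.updateTime σ k j * τs))
      (E (D.updateTime σ k j))) atTop (𝓝 0) := by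
  classical
  have : Nonempty ι := ⟨σ 0⟩
  set r := D.updateTime σ k with hr
  have hrsucc : ∀ j, r (j + 1) = r j + D.blockLen σ (r j) := fun j => rfl
  set v := fun j => D.V (σ (r j * τs)) (x (r j * τs)) (E (r j)) with hv
  have hmono : Monotone r := (hD.strictMono_updateTime hn σ k).monotone
  have hv0 : ∀ j, 0 ≤ v j := fun j => hD.V_nonneg _ _ _
  have hno : ∀ j, σ (r (j + 1) * τs) = σ (r j * τs) → v (j + 1) ≤ D.nu * v j := fun j hj =>
    ((hz.blocks j).V_noSwitch hD hn hz.plant (hD.sample_le_updateTime hn hτs σ k j) hτs hσ hdwell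
      (hz.error_le hD hn hτs hσ hdwell j) hj).trans
        (mul_le_mul_of_nonneg_right (D.nu_p_le_nu _) (hv0 j))
  have hsw : ∀ j, σ (r (j + 1) * τs) ≠ σ (r j * τs) → v (j + 1) ≤ D.nuBar * v j := fun j hj =>
    ((hz.blocks j).switch hD hn hz.plant (hD.sample_le_updateTime hn hτs σ k j) hτs hσ hdwell
      (hz.error_le hD hn hτs hσ hdwell j) hj).2.trans
        (mul_le_mul_of_nonneg_right (D.nuBar_pq_le_nuBar hj.symm
          (hD.one_le_blockLen hn σ _) (D.blockLen_le σ _)) (hv0 j))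
  have hν0 := hD.nu_nonneg hn
  have hν1 := hD.nu_lt_one hn
  -- For `ν̄ < 1` every block contracts and no switch counting is needed. This includes the case of
  -- a single mode, where `nuBar` is `sSup ∅ = 0`. Otherwise `log ν̄ ≥ 0`, as the two-rate argument
  -- uses.
  rcases lt_or_ge D.nuBar 1 with hlt | hge
  · have hmax : max D.nu D.nuBar < 1 := max_lt hν1 hlt
    have hgeo : ∀ j, v j ≤ v 0 * max D.nu D.nuBar ^ j := by
      intro j
      induction j with
      | zero => simp
      | succ j ih =>
        have h1 : v (j + 1) ≤ max D.nu D.nuBar * v j := by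
          by_cases h : σ (r (j + 1) * τs) = σ (r j * τs)
          · exact (hno j h).trans (mul_le_mul_of_nonneg_right (le_max_left _ _) (hv0 j))
          · exact (hsw j h).trans (mul_le_mul_of_nonneg_right (le_max_right _ _) (hv0 j))
        refine h1.trans ((mul_le_mul_of_nonneg_left ih (le_max_of_le_left hν0)).trans_eq ?_)
        ring
    refine squeeze_zero hv0 hgeo ?_
    simpa using (tendsto_pow_atTop_nhds_zero_of_lt_one (le_max_of_le_left hν0) hmax).const_mul
      (v 0)
  · have ha : 0 ≤ Real.log D.nuBar := Real.log_nonneg hge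
    obtain ⟨b, hb, hνb, hab⟩ := exists_decay_exponent ha hν0 hν1 (by positivity) hcond
    refine tendsto_zero_of_two_rates hv0
      (s := fun j => if σ (r (j + 1) * τs) = σ (r j * τs) then 0 else 1)
      (a := Real.log D.nuBar) (b := b) (c := S.etaMax τs * τs / τa) (N₀ := N0)
      (by positivity) ?_ ?_ ?_ ?_
    · rw [← mul_div_assoc, div_lt_iff₀ hτa]
      exact hab
    · intro j hj
      have hj' : σ (r (j + 1) * τs) = σ (r j * τs) := by simpa using hj
      exact (hno j hj').trans (mul_le_mul_of_nonneg_right hνb (hv0 j))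
    · intro j hj
      have hj' : σ (r (j + 1) * τs) ≠ σ (r j * τs) := by simpa using hj
      rw [Real.exp_log (by linarith)]
      exact ⟨if_neg hj', hsw j hj'⟩
    · refine fun J => sum_le_of_averageDwellTime hσ hτs hτa hadt hmono ?_ ?_ ?_ J
      · intro j
        rw [hrsucc]
        exact Nat.add_le_add_left ((D.blockLen_le σ _).trans (S.eta_le_etaMax τs _)) _
      · intro j
        split_ifs <;> simp
      · intro j hj
        have hj' : σ (r (j + 1) * τs) ≠ σ (r j * τs) := by simpa using hj
        refine hσ.one_le_numSwitches (by positivity) ?_ hj'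
        gcongr
        exact hmono j.le_succ

theorem IsZoomIn.tendsto [Fintype ι] (hz : D.IsZoomIn σ x u ξ E q k)
    (hD : D.IsAdmissible) (hn : 1 ≤ n)
    (hτs : 0 < τs) (hσ : IsSwitchingSignal σ) (hdwell : HasDwellTime σ τs)
    {τa : ℝ} (hτa : 0 < τa) {N0 : ℕ} (hadt : HasAverageDwellTime σ τa N0)
    (hcond : (1 + Real.log D.nuBar / Real.log (1 / D.nu)) * (S.etaMax τs * τs) < τa) :
    Tendsto (fun k : ℕ => D.V (σ (k * τs)) (x (k * τs)) (E k)) atTop (𝓝 0) ∧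
      Tendsto x atTop (𝓝 0) := by
  have : Nonempty ι := ⟨σ 0⟩
  have hV := hz.tendsto_V_updateTime hD hn hτs hσ hdwell hτa hadt hcond
  have herr := hz.error_le hD hn hτs hσ hdwell
  have hsm := hD.strictMono_updateTime hn σ k
  have hblock := hz.blocks
  have hle := hD.sample_le_updateTime hn hτs σ k
  obtain ⟨c, hc, hclow⟩ := hD.exists_V_lower hn
  obtain ⟨d, hd, hdup⟩ := hD.exists_V_upper hn
  obtain ⟨M, hM, hbound⟩ := D.exists_block_bound hτs
  have hrsucc : ∀ j, D.updateTime σ k (j + 1) =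
    D.updateTime σ k j + D.blockLen σ (D.updateTime σ k j) := fun j => rfl
  set r := D.updateTime σ k with hr
  have hsq : Tendsto (fun j => ‖x (r j * τs)‖ ^ 2 + E (r j) ^ 2) atTop (𝓝 0) := by
    have h := hV.const_mul c⁻¹
    rw [mul_zero] at h
    refine squeeze_zero (fun j => by positivity) (fun j => ?_) h
    rw [inv_mul_eq_div, le_div_iff₀ hc, mul_comm]
    exact hclow _ _ _
  have hx0 : Tendsto (fun j => ‖x (r j * τs)‖) atTop (𝓝 0) := by
    have h := squeeze_zero (fun j => sq_nonneg ‖x (r j * τs)‖)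
      (fun j => le_add_of_nonneg_right (sq_nonneg (E (r j)))) hsq
    simpa using h.sqrt
  have hE0 : Tendsto (fun j => E (r j)) atTop (𝓝 0) := by
    have h := squeeze_zero (fun j => sq_nonneg (E (r j)))
      (fun j => le_add_of_nonneg_left (sq_nonneg ‖x (r j * τs)‖)) hsq
    have hnn : ∀ j, 0 ≤ E (r j) := fun j => (norm_nonneg _).trans (herr j)
    simpa [Real.sqrt_sq (hnn _)] using h.sqrt
  -- Since `‖ξ‖ ≤ ‖x‖ + E` at a block start, `g j` bounds `x` on the whole block `j`.
  set g : ℕ → ℝ := fun j => M * (2 * ‖x (r j * τs)‖ + E (r j)) with hg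
  have hg0 : Tendsto g atTop (𝓝 0) := by
    simpa using ((hx0.const_mul 2).add hE0).const_mul M
  have hxg : ∀ j, ∀ t ∈ Icc ((r j : ℝ) * τs) (r (j + 1) * τs), ‖x t‖ ≤ g j := by
    intro j t ht
    refine (hbound σ x u ξ E q (r j) _ (hblock j) hz.plant (hle j) t ht).trans
      (mul_le_mul_of_nonneg_left ?_ hM)
    have h1 : ‖ξ (r j * τs)‖ ≤ ‖x (r j * τs)‖ + E (r j) := by
      rw [← sub_sub_cancel (x (r j * τs)) (ξ (r j * τs))]
      exact (norm_sub_le _ _).trans (add_le_add le_rfl (herr j))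
    linarith
  constructor
  · have hh : Tendsto (fun j => d * (g j ^ 2 + E (r j) ^ 2)) atTop (𝓝 0) := by
      simpa using ((hg0.pow 2).add (hE0.pow 2)).const_mul d
    refine tendsto_zero_of_frequent_bound hh fun J => ?_
    filter_upwards [eventually_ge_atTop (r J)] with i hi
    obtain ⟨j, hj, hmem⟩ := hsm.exists_mem_Ico hτs (J := J) (t := i * τs) (by gcongr)
    refine ⟨j, hj, ?_⟩
    rw [Real.norm_of_nonneg (hD.V_nonneg _ _ _)]
    refine (hdup _ _ _).trans (mul_le_mul_of_nonneg_left ?_ hd.le)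
    have h1 : r j ≤ i := by
      have := le_of_mul_le_mul_right hmem.1 hτs
      exact_mod_cast this
    have h2 : i < r (j + 1) := by
      have := lt_of_mul_lt_mul_right hmem.2 hτs.le
      exact_mod_cast this
    have hEi : E i = E (r j) := by
      have h := (hblock j).hold (i - r j) (by rw [hrsucc] at h2; omega)
      rwa [Nat.add_sub_cancel' h1] at h
    rw [hEi]
    gcongr
    exact hxg j _ ⟨hmem.1, hmem.2.le⟩
  · refine tendsto_zero_of_frequent_bound hg0 fun J => ?_
    filter_upwards [eventually_ge_atTop (r J * τs)] with t ht
    obtain ⟨j, hj, hmem⟩ := hsm.exists_mem_Ico hτs ht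
    exact ⟨j, hj, hxg j t ⟨hmem.1, hmem.2.le⟩⟩

end Design

namespace Design

variable {ι : Type*} {n m l : ℕ} {S : SwitchedSystem ι n m l} {τs : ℝ} {D : Design S τs}
  {σ : ℝ → ι} {x : ℝ → Fin n → ℝ} {u : ℝ → Fin m → ℝ} {ξ : ℝ → Fin n → ℝ}
  {E : ℕ → ℝ} {q : ℕ → Fin l → ℝ} {μ₀ χ : ℝ}

/-! ### The zooming-out stage -/

/-- The radius exceeds the growth bound of the free state by the factor `e^{χ maxA k τs}`, which
diverges only if `maxA > 0`; hence the assumption that some `A_p` is nonzero. -/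
theorem exists_output_le_zoomRadius [Finite ι] (D : Design S τs) (hτs : 0 < τs)
    (hA : ∃ p, S.A p ≠ 0) (hμ : 0 < μ₀) (hχ : 0 < χ) (hx : S.IsSolution σ u x 0)
    (hu : ∀ t, 0 ≤ t → u t = 0) :
    ∃ k₁ : ℕ, ∀ k ≥ k₁, ‖S.C (σ (k * τs)) *ᵥ x (k * τs)‖ ≤ D.zoomRadius μ₀ χ k := by
  have hA0 : 0 < S.maxA := by
    obtain ⟨p, hp⟩ := hA
    exact ((infNorm_nonneg _).lt_of_ne' (infNorm_ne_zero hp)).trans_le (S.infNorm_A_le_maxA p)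
  set c := ⨆ p, infNorm (S.C p) with hc
  have hc0 : 0 ≤ c := Real.iSup_nonneg fun p => infNorm_nonneg _
  have hlim : Tendsto (fun k : ℕ => Real.exp (k * (χ * S.maxA * τs)) * μ₀) atTop atTop :=
    (Real.tendsto_exp_atTop.comp
      (tendsto_natCast_atTop_atTop.atTop_mul_const (by positivity))).atTop_mul_const hμ
  obtain ⟨k₁, hk₁⟩ := eventually_atTop.1 (hlim.eventually_ge_atTop (c * ‖x 0‖))
  refine ⟨k₁, fun k hk => ?_⟩
  have h1 := hx.norm_le_of_input_zero (a := 0) (b := k * τs) le_rfl (by positivity)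
    fun t ht => hu t ht.1
  rw [sub_zero] at h1
  have h2 : infNorm (S.C (σ (k * τs))) ≤ c :=
    le_ciSup (f := fun p => infNorm (S.C p)) (Finite.bddAbove_range _) _
  calc ‖S.C (σ (k * τs)) *ᵥ x (k * τs)‖ ≤ infNorm (S.C (σ (k * τs))) * ‖x (k * τs)‖ :=
        norm_mulVec_le_infNorm _ _
    _ ≤ c * (Real.exp (S.maxA * (k * τs)) * ‖x 0‖) := mul_le_mul h2 h1 (norm_nonneg _) hc0
    _ = Real.exp (S.maxA * (k * τs)) * (c * ‖x 0‖) := by ring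
    _ ≤ Real.exp (S.maxA * (k * τs)) * (Real.exp (k * (χ * S.maxA * τs)) * μ₀) :=
        mul_le_mul_of_nonneg_left (hk₁ k hk) (Real.exp_pos _).le
    _ = D.zoomRadius μ₀ χ k := by
        rw [zoomRadius, ← mul_assoc, ← Real.exp_add]
        ring_nf

/-- Otherwise each of `J` consecutive windows of `η` samples contains a switch, so `J ≤ N0 + J η τs
/ τa` for all `J`, which fails for large `J` because `η τs < τa`. -/
theorem exists_window_without_switch [Fintype ι] (S : SwitchedSystem ι n m l) (hτs : 0 < τs)
    (hσ : IsSwitchingSignal σ) {τa : ℝ} (hτa : S.etaMax τs * τs < τa) {N0 : ℕ}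
    (hadt : HasAverageDwellTime σ τa N0) (k₁ : ℕ) :
    ∃ k ≥ k₁, ∀ i < S.eta τs (σ (k * τs)), σ ((k + i : ℕ) * τs) = σ (k * τs) := by
  by_contra! hcon
  have hτa0 : 0 < τa := lt_of_le_of_lt (by positivity) hτa
  set r : ℕ → ℕ := fun j => k₁ + j * S.etaMax τs with hr
  have hmono : Monotone r := fun a b hab =>
    Nat.add_le_add_left (Nat.mul_le_mul_right _ hab) _
  have hsum := sum_le_of_averageDwellTime hσ hτs hτa0 hadt hmono (η := S.etaMax τs)
    (fun j => by simp only [hr, Nat.succ_mul]; omega) (s := fun _ => 1) (fun _ => le_rfl)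
    (fun j _ => by
      obtain ⟨i, hi, hne⟩ := hcon (r j) (Nat.le_add_right _ _)
      have hi' : r j + i ≤ r (j + 1) := by
        have := S.eta_le_etaMax τs (σ (r j * τs))
        simp only [hr, Nat.succ_mul] at *
        omega
      have hji : ((r j : ℕ) : ℝ) * τs ≤ (r j + i : ℕ) * τs := by gcongr; omega
      have h1 := hσ.one_le_numSwitches (by positivity) hji hne
      rw [← hσ.numSwitches_add hji (c := r (j + 1) * τs) (by gcongr)]
      omega)
  simp only [Finset.sum_const, Finset.card_range, smul_eq_mul, mul_one] at hsum
  have hlt : S.etaMax τs * τs / τa < 1 := (div_lt_one hτa0).2 hτa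
  obtain ⟨J, hJ⟩ := exists_nat_gt (N0 / (1 - S.etaMax τs * τs / τa))
  rw [div_lt_iff₀ (by linarith)] at hJ
  linarith [hsum J]

theorem IsClosedLoop.exists_isLeast [Fintype ι] (hcl : D.IsClosedLoop μ₀ χ σ x u ξ E q)
    (hτs : 0 < τs) (hσ : IsSwitchingSignal σ) {τa : ℝ} (hτa : S.etaMax τs * τs < τa) {N0 : ℕ}
    (hadt : HasAverageDwellTime σ τa N0) (hA : ∃ p, S.A p ≠ 0) (hμ : 0 < μ₀) (hχ : 0 < χ) :
    ∃ n₀, IsLeast {k | D.Captured μ₀ χ σ x k} n₀ := by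
  classical
  by_cases hex : ∃ k, D.Captured μ₀ χ σ x k
  · exact ⟨Nat.find hex, Nat.find_spec hex, fun k hk => Nat.find_min' hex hk⟩
  · exfalso
    -- Without a capture the zooming-out condition holds vacuously at all times, so the input is `0`
    -- for ever.
    obtain ⟨k₁, hk₁⟩ := D.exists_output_le_zoomRadius hτs hA hμ hχ hcl.plant fun t ht =>
      hcl.zoomOut t ht fun n₀ hn₀ => absurd ⟨n₀, hn₀.1⟩ hex
    obtain ⟨k, hk, hwin⟩ := exists_window_without_switch S hτs hσ hτa hadt k₁
    exact hex ⟨k, fun i hi => ⟨hwin i hi, hk₁ _ (hk.trans (Nat.le_add_right _ _))⟩⟩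

theorem zoomRadius_mono (D : Design S τs) (hτs : 0 < τs) (hμ : 0 < μ₀) (hχ : 0 < χ) :
    Monotone (D.zoomRadius μ₀ χ) := by
  intro i j hij
  have := S.maxA_nonneg
  unfold zoomRadius
  gcongr

theorem zoomRadius_nonneg (D : Design S τs) (hμ : 0 < μ₀) (χ : ℝ) (i : ℕ) :
    0 ≤ D.zoomRadius μ₀ χ i := by
  unfold zoomRadius
  positivity

theorem IsClosedLoop.isZoomIn [Finite ι] (hcl : D.IsClosedLoop μ₀ χ σ x u ξ E q)
    (hD : D.IsAdmissible) (hn : 1 ≤ n) (hτs : 0 < τs) (hσ : IsSwitchingSignal σ)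
    (hdwell : HasDwellTime σ τs) (hμ : 0 < μ₀) (hχ : 0 < χ) {n₀ : ℕ}
    (hn₀ : IsLeast {k | D.Captured μ₀ χ σ x k} n₀) :
    D.IsZoomIn σ x u ξ E q (n₀ + S.eta τs (σ (n₀ * τs))) := by
  have hu : ∀ t, 0 ≤ t → t < (n₀ + S.eta τs (σ (n₀ * τs)) : ℕ) * τs → u t = 0 :=
    fun t ht ht' => hcl.zoomOut t ht fun k hk => by rwa [hk.unique hn₀]
  have hcap : D.Captured μ₀ χ σ x n₀ := hn₀.1
  have hblocks := hcl.zoomIn_blocks n₀ hn₀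
  have hξ := hcl.zoomIn_estimate n₀ hn₀
  have hE := hcl.zoomIn_bound n₀ hn₀
  have hη := hD.one_le_eta hn (σ (n₀ * τs))
  have hx := hcl.plant
  unfold Captured at hcap
  set p := σ (n₀ * τs) with hp
  set η := S.eta τs p with hηdef
  have hn0 : 0 ≤ (n₀ : ℝ) * τs := by positivity
  refine ⟨⟨hx.1.mono (Ici_subset_Ici.2 (by positivity)),
    fun t ht => hx.2 t (le_trans (by positivity) ht)⟩, ?_, hblocks⟩
  -- The mode is known only up to the last captured sample, `n₀ + η - 1`. A switch may occur in the
  -- interval after it, which is why the initial bound uses the mode-independent factor `e^{maxA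
  -- τs}` there.
  have hconst := hσ.eqOn_of_samples hτs hdwell n₀ (η - 1) fun i hi => (hcap i (by omega)).1
  have hfree : ∀ i < η, x ((n₀ + i : ℕ) * τs) = mexp (S.A p) (i * τs) *ᵥ x (n₀ * τs) := by
    intro i hi
    have hle : (n₀ : ℝ) * τs ≤ (n₀ + i : ℕ) * τs := by gcongr; omega
    have hle' : ((n₀ + i : ℕ) : ℝ) * τs ≤ (n₀ + (η - 1) : ℕ) * τs := by gcongr; omega
    have hlt : ((n₀ + i : ℕ) : ℝ) * τs ≤ (n₀ + η : ℕ) * τs := by gcongr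
    have h := variation_of_constants (A := S.A p) (G := fun _ => 0) continuous_const
      (x := x) (v := 0) hle (hx.1.mono fun t ht => hn0.trans ht.1) (fun t ht => by
        have h := hx.2 t (hn0.trans ht.1)
        rw [hu t (hn0.trans ht.1) (ht.2.trans_le hlt),
          hconst t ⟨ht.1, ht.2.le.trans hle'⟩] at h
        simpa using h)
    rw [show ((n₀ + i : ℕ) : ℝ) * τs - n₀ * τs = i * τs by push_cast; ring] at h
    simpa using h
  have hout : ‖S.W τs p η *ᵥ x (n₀ * τs)‖ ≤ D.zoomRadius μ₀ χ (n₀ + η - 1) := by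
    rw [pi_norm_le_iff_of_nonneg (D.zoomRadius_nonneg hμ χ _)]
    intro a
    obtain ⟨hmode, hbd⟩ := hcap a.1 a.1.2
    rw [S.W_mulVec, ← hfree a.1 a.1.2]
    rw [hmode] at hbd
    exact (norm_le_pi_norm _ _).trans (hbd.trans (D.zoomRadius_mono hτs hμ hχ (by omega)))
  have hstart : ‖x (n₀ * τs)‖ ≤ infNorm (D.Wd p) * D.zoomRadius μ₀ χ (n₀ + η - 1) := by
    have h : x (n₀ * τs) = D.Wd p *ᵥ (S.W τs p η *ᵥ x (n₀ * τs)) := by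
      rw [Matrix.mulVec_mulVec, hD.leftInverse, Matrix.one_mulVec]
    rw [h]
    exact (norm_mulVec_le_infNorm _ _).trans
      (mul_le_mul_of_nonneg_left hout (infNorm_nonneg _))
  have hlast := hx.norm_le_of_input_zero (a := (n₀ + (η - 1) : ℕ) * τs) (b := (n₀ + η : ℕ) * τs)
    (by positivity) (by gcongr; omega) fun t ht => hu t (le_trans (by positivity) ht.1) ht.2
  rw [hξ, sub_zero, hE]
  refine hlast.trans ?_
  rw [hfree (η - 1) (by omega)]
  have hlen : ((n₀ + η : ℕ) : ℝ) * τs - (n₀ + (η - 1) : ℕ) * τs = τs := by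
    push_cast [Nat.cast_sub hη]
    ring
  rw [hlen, mul_assoc, Nat.cast_sub hη, Nat.cast_one]
  refine mul_le_mul_of_nonneg_left ?_ (Real.exp_pos _).le
  exact (norm_mulVec_le_infNorm _ _).trans
    (mul_le_mul_of_nonneg_left hstart (infNorm_nonneg _))

end Design

theorem mainTheorem3 {ι : Type*} [Fintype ι] {n m l : ℕ} (hn : 1 ≤ n)
    (S : SwitchedSystem ι n m l) (τs : ℝ) (hτs : 0 < τs)
    (D : Design S τs) (hD : D.IsAdmissible)
    (σ : ℝ → ι) (hσ : IsSwitchingSignal σ) (hdwell : HasDwellTime σ τs)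
    (τa : ℝ) (hτa : 0 < τa) (N0 : ℕ) (hadt : HasAverageDwellTime σ τa N0)
    (hcond : (1 + Real.log D.nuBar / Real.log (1 / D.nu)) * (S.etaMax τs * τs) < τa) :
    (∀ (k₀ : ℕ) (x : ℝ → Fin n → ℝ) (u : ℝ → Fin m → ℝ) (ξ : ℝ → Fin n → ℝ) (E : ℕ → ℝ)
        (q : ℕ → Fin l → ℝ), D.IsZoomIn σ x u ξ E q k₀ →
      Tendsto (fun k : ℕ => D.V (σ (k * τs)) (x (k * τs)) (E k)) atTop (𝓝 0) ∧
      Tendsto x atTop (𝓝 0)) ∧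
    ((∃ p, S.A p ≠ 0) → S.etaMax τs * τs < τa →
      ∀ (μ₀ χ : ℝ), 0 < μ₀ → 0 < χ →
      ∀ (x : ℝ → Fin n → ℝ) (u : ℝ → Fin m → ℝ) (ξ : ℝ → Fin n → ℝ) (E : ℕ → ℝ)
        (q : ℕ → Fin l → ℝ), D.IsClosedLoop μ₀ χ σ x u ξ E q →
      (∃ n₀, IsLeast {k | D.Captured μ₀ χ σ x k} n₀) ∧
      Tendsto (fun k : ℕ => D.V (σ (k * τs)) (x (k * τs)) (E k)) atTop (𝓝 0) ∧
      Tendsto x atTop (𝓝 0)) := by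
  refine ⟨fun k₀ x u ξ E q hz => hz.tendsto hD hn hτs hσ hdwell hτa hadt hcond, ?_⟩
  intro hA hτ μ₀ χ hμ hχ x u ξ E q hcl
  obtain ⟨n₀, hn₀⟩ := hcl.exists_isLeast hτs hσ hτ hadt hA hμ hχ
  exact ⟨⟨n₀, hn₀⟩, (hcl.isZoomIn hD hn hτs hσ hdwell hμ hχ hn₀).tendsto hD hn hτs hσ hdwell
    hτa hadt hcond⟩
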